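/- For real parameters $a,b$ let $L_{a,b}(x,y)=(1+y-a|x|,\,bx)$ be the Lozi map, and let $$X=\Big(\tfrac{1}{1+a-b},\tfrac{b}{1+a-b}\Big),\qquad Z=\Big(\tfrac{2+a+\sqrt{a^2+4b}}{2(1+a-b)},\,0\Big),$$ $$P=\Big(\tfrac{1+a-b}{a^2+(1-b)^2},\tfrac{b(1-a-b)}{a^2+(1-b)^2}\Big),\qquad P'=\Big(\tfrac{1-a-b}{a^2+(1-b)^2},\tfrac{b(1+a-b)}{a^2+(1-b)^2}\Big).$$ Here $X$ is the saddle fixed point in the first quadrant. Write $Z^n=L_{a,b}^n(Z)$ for $n\in\mathbb Z$. Let $W^u_X$ be the unstable manifold of $X$, that is, the set of all points $q$ with $L_{a,b}^{-n}(q)\to X$ as $n\to\infty$. Let $R$ be the set of all $(a,b)$ such that $0<b<1$, $1-b<a<1+b$ and, for every integer $k\ge 0$, $Z^{2k-1}$ lies in the closed left half-plane and $Z^{2k}$ lies in the closed right half-plane. The equation $\sqrt2\,e^{-7\pi t/4}=1+t$ has a unique real root $t_0$, and $t_0\approx 0.0535502597736068$ (with error less than $10^{-16}$). There is a positive lower semi-continuous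 function $t\mapsto a(t)$ on $(t_0,1)$ such that, whenever $t_0<t<1$, $0<a<a(t)$ and $b=1-ta$: 1. all even images $Z^{2k}$ $(k\ge1)$ lie in the open fourth quadrant and all odd images $Z^{2k-1}$ $(k\ge1)$ lie in the open second quadrant; 2. $(a,b)\in R$; 3. $\{P,P'\}$ is an orbit of period two, and $W^u_X$ is attracted to it: for every $q\in W^u_X\setminus\{X\}$, one of the sequences $L_{a,b}^{2n}(q)$, $L_{a,b}^{2n+1}(q)$ converges to $P$ and the other one to $P'$ as $n\to\infty$; 4. $\overline{W^u_X}=W^u_X\cup\{P,P'\}$. Consequently $R$ contains the set $\{(a,1-ta): t_0<t<1,\ 0<a<a(t)\}$, which is open, simply connected, and has $(0,1)$ in its closure. -/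

import Mathlib

open Set Filter Topology

namespace Lozi

/-- The Lozi map `L_{a,b}(x, y) = (1 + y - a|x|, b x)` of the plane. -/
noncomputable def map (a b : ℝ) (p : ℝ × ℝ) : ℝ × ℝ :=
  (1 + p.2 - a * |p.1|, b * p.1)

/-- The inverse of the Lozi map (for `b ≠ 0`). -/
noncomputable def mapInv (a b : ℝ) (p : ℝ × ℝ) : ℝ × ℝ :=
  (p.2 / b, p.1 - 1 + a * |p.2 / b|)

theorem mapInv_map {a b : ℝ} (hb : b ≠ 0) (p : ℝ × ℝ) : mapInv a b (map a b p) = p := by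
  ext
  · simp [map, mapInv, hb]
  · simp only [map, mapInv, mul_div_cancel_left₀ _ hb]
    ring

theorem map_mapInv {a b : ℝ} (hb : b ≠ 0) (p : ℝ × ℝ) : map a b (mapInv a b p) = p := by
  ext
  · simp only [map, mapInv]
    ring
  · simp only [map, mapInv]
    field_simp

/-- The integer iterates `L_{a,b}^n` of the Lozi map (for `b ≠ 0`). -/
noncomputable def iter (a b : ℝ) : ℤ → ℝ × ℝ → ℝ × ℝ
  | Int.ofNat n => (map a b)^[n]
  | Int.negSucc n => (mapInv a b)^[n + 1]

/-- The fixed point `X` of the Lozi map in the first quadrant. -/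
noncomputable def ptX (a b : ℝ) : ℝ × ℝ :=
  (1 / (1 + a - b), b / (1 + a - b))

/-- The point `Z` at which the half of the unstable manifold of `X` that starts to the right
first meets the horizontal axis. -/
noncomputable def ptZ (a b : ℝ) : ℝ × ℝ :=
  ((2 + a + √(a ^ 2 + 4 * b)) / (2 * (1 + a - b)), 0)

/-- The point `P` of period two, in the fourth quadrant. -/
noncomputable def ptP (a b : ℝ) : ℝ × ℝ :=
  ((1 + a - b) / (a ^ 2 + (1 - b) ^ 2), b * (1 - a - b) / (a ^ 2 + (1 - b) ^ 2))

/-- The point `P'` of period two, in the second quadrant. -/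
noncomputable def ptP' (a b : ℝ) : ℝ × ℝ :=
  ((1 - a - b) / (a ^ 2 + (1 - b) ^ 2), b * (1 + a - b) / (a ^ 2 + (1 - b) ^ 2))

theorem map_ptX {a b : ℝ} (h : 0 < 1 + a - b) : map a b (ptX a b) = ptX a b := by
  have h0 : (0 : ℝ) ≤ 1 / (1 + a - b) := by positivity
  ext
  · simp only [map, ptX, abs_of_nonneg h0]
    field_simp
    ring
  · simp only [map, ptX]
    ring

/-- The unstable manifold `W^u_X` of the fixed point `X`: the set of all points whose backward
orbit converges to `X`. -/
def unstableManifold (a b : ℝ) : Set (ℝ × ℝ) :=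
  {q | Tendsto (fun n : ℕ => iter a b (-(n : ℤ)) q) atTop (𝓝 (ptX a b))}

/-- The open second quadrant. -/
def secondQuadrant : Set (ℝ × ℝ) := {p | p.1 < 0 ∧ 0 < p.2}

/-- The open fourth quadrant. -/
def fourthQuadrant : Set (ℝ × ℝ) := {p | 0 < p.1 ∧ p.2 < 0}

/-- The region `R` of parameters `(a, b)` such that `0 < b < 1`, `1 - b < a < 1 + b` and, for all
`k ≥ 0`, the point `Z^{2k-1}` is in the closed left half-plane and the point `Z^{2k}` is in the
closed right half-plane. (The half-planes have to be closed: `Z^{-1}` is on the vertical axis.) -/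
def regionR : Set (ℝ × ℝ) :=
  {c | 0 < c.2 ∧ c.2 < 1 ∧ 1 - c.2 < c.1 ∧ c.1 < 1 + c.2 ∧
    ∀ k : ℕ, (iter c.1 c.2 (2 * (k : ℤ) - 1) (ptZ c.1 c.2)).1 ≤ 0 ∧
      0 ≤ (iter c.1 c.2 (2 * (k : ℤ)) (ptZ c.1 c.2)).1}

/-- The orbit of `q` under the Lozi map is attracted to the orbit `p, p'` of period two: its even
terms converge to one of the two points and its odd terms to the other one. -/
def AttractedToPair (a b : ℝ) (p p' q : ℝ × ℝ) : Prop :=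
  (Tendsto (fun n : ℕ => iter a b (2 * (n : ℤ)) q) atTop (𝓝 p) ∧
      Tendsto (fun n : ℕ => iter a b (2 * (n : ℤ) + 1) q) atTop (𝓝 p')) ∨
    (Tendsto (fun n : ℕ => iter a b (2 * (n : ℤ)) q) atTop (𝓝 p') ∧
      Tendsto (fun n : ℕ => iter a b (2 * (n : ℤ) + 1) q) atTop (𝓝 p))

/-- The parameters `(a, b)` with `b = 1 - t a` for some `t` in `(t₀, 1)` and `0 < a < α t`. -/
def parameterRegion (t₀ : ℝ) (α : ℝ → ℝ) : Set (ℝ × ℝ) :=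
  {c | ∃ t ∈ Ioo t₀ 1, 0 < c.1 ∧ c.1 < α t ∧ c.2 = 1 - t * c.1}

end Lozi

namespace Lozi

/-! ### The threshold for `t` -/

/-! Where `p` lies in the right and `L p` in the left half-plane, `L²` agrees with the affine map
`turn`. Its fixed point is `P` and its linear part has trace `2b - a²` and determinant `b²`, so it
is conjugate to a rotation by an angle `φ` times `b`. As long as they alternate sides, the points
`Z^{2k}` are therefore samples of a spiral around `P`, and the claim on quadrants says that this
spiral misses the axes.

Put `b = 1 - ta`, `θ = kφ` and let `a → 0`. Then `φ/a → 1`, `b^k` becomes `exp(-tθ)`, and after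
scaling by `a` the spiral has a limit. With `κ = (1-t)/(1+t)` the conditions become `exp(-tθ)(κ² cos
θ + κ sin θ) > -1` and `exp(-tθ)(cos θ - κ sin θ) < 1`. The second is critical at the local maximum
`θ = 7π/4`, where it reads `√2 exp(-7πt/4) < 1 + t`: this is the threshold. The first is critical at
`5π/4` and then follows. These strict inequalities persist near `(t, 0)` (`eventually_admissible`),
which gives `Controlled` parameters (`Admissible.controlled`); a partition of unity turns the local
bounds on `a` into a continuous, hence lower semi-continuous, function.

For controlled parameters, a fundamental segment of the unstable line ends at `Z`, and `turn`
carries its initial point to `Z`. Its images are thus segments joining consecutive points of the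
orbit of `Z`. By convexity they stay where `L² = turn`, and they shrink to `P`. All of `W^u_X` comes
from these segments, their images under `L`, and one segment through `X`; attraction and the closure
follow. -/

theorem strictAnti_threshold :
    StrictAnti fun s : ℝ => √2 * Real.exp (-(7 / 4 * Real.pi * s)) - (1 + s) := by
  intro x y hxy
  have h : Real.exp (-(7 / 4 * Real.pi * y)) < Real.exp (-(7 / 4 * Real.pi * x)) := by
    apply Real.exp_lt_exp.2
    nlinarith [Real.pi_pos]
  have h2 : (0 : ℝ) < √2 := by positivity
  have := mul_lt_mul_of_pos_left h h2
  simp only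
  linarith

/-- Clearing the negative exponential leaves `(1 + s) exp(7πs/4) < √2`, which is decided by decimal
bounds for `π` and `√2` and a Taylor bound with 14 terms. -/
theorem threshold_lower : 0 < √2 * Real.exp (-(7 / 4 * Real.pi * 0.0535502597736067001)) -
    (1 + 0.0535502597736067001) := by
  have hX : Real.exp (7 / 4 * Real.pi * 0.0535502597736067001) ≤
      Real.exp (7 / 4 * 3.14159265358979323847 * 0.0535502597736067001) := by
    apply Real.exp_le_exp.2
    nlinarith [Real.pi_lt_d20]
  have hb := Real.exp_bound' (x := 7 / 4 * 3.14159265358979323847 * 0.0535502597736067001)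
    (by norm_num) (by norm_num) (n := 14) (by norm_num)
  have h2 : (1.41421356237309504 : ℝ) < √2 := by
    apply Real.lt_sqrt_of_sq_lt
    norm_num
  have hc : (1 + 0.0535502597736067001) *
      Real.exp (7 / 4 * Real.pi * 0.0535502597736067001) < √2 := by
    refine lt_of_le_of_lt ?_ h2
    refine le_trans (mul_le_mul_of_nonneg_left (hX.trans hb) (by norm_num)) ?_
    norm_num [Finset.sum_range_succ, Nat.factorial]
  rw [Real.exp_neg, ← div_eq_mul_inv, sub_pos, lt_div_iff₀ (Real.exp_pos _)]
  exact hc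

theorem threshold_upper : √2 * Real.exp (-(7 / 4 * Real.pi * 0.0535502597736068999)) -
    (1 + 0.0535502597736068999) < 0 := by
  have hX : Real.exp (7 / 4 * 3.14159265358979323846 * 0.0535502597736068999) ≤
      Real.exp (7 / 4 * Real.pi * 0.0535502597736068999) := by
    apply Real.exp_le_exp.2
    nlinarith [Real.pi_gt_d20]
  have hb := Real.sum_le_exp_of_nonneg
    (x := 7 / 4 * 3.14159265358979323846 * 0.0535502597736068999) (by norm_num) 14
  have h2 : √2 < (1.41421356237309505 : ℝ) := by
    rw [Real.sqrt_lt' (by norm_num)]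
    norm_num
  have hc : √2 < (1 + 0.0535502597736068999) *
      Real.exp (7 / 4 * Real.pi * 0.0535502597736068999) := by
    refine h2.trans_le ?_
    refine le_trans ?_ (mul_le_mul_of_nonneg_left (hb.trans hX) (by norm_num))
    norm_num [Finset.sum_range_succ, Nat.factorial]
  rw [Real.exp_neg, ← div_eq_mul_inv, sub_neg, div_lt_iff₀ (Real.exp_pos _)]
  exact hc

theorem exists_threshold : ∃ t₀ : ℝ, 0 < t₀ ∧ t₀ < 1 ∧
    (∀ s : ℝ, √2 * Real.exp (-(7 / 4 * Real.pi * s)) = 1 + s ↔ s = t₀) ∧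
    |t₀ - 0.0535502597736068| < 1 / 10 ^ 16 ∧
    ∀ s, t₀ < s → √2 * Real.exp (-(7 / 4 * Real.pi * s)) < 1 + s := by
  -- The endpoints lie `0.999 · 10⁻¹⁶` on either side of the stated decimal, so any zero between
  -- them has the required accuracy.
  obtain ⟨t₀, ht, h0⟩ := intermediate_value_Icc'
    (f := fun s : ℝ => √2 * Real.exp (-(7 / 4 * Real.pi * s)) - (1 + s))
    (a := 0.0535502597736067001) (b := 0.0535502597736068999) (by norm_num)
    (by fun_prop) ⟨threshold_upper.le, threshold_lower.le⟩
  have h1 := ht.1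
  have h2 := ht.2
  norm_num at h1 h2
  refine ⟨t₀, by linarith, by linarith, fun s => ⟨fun h => ?_, ?_⟩, ?_, fun s hs => ?_⟩
  · apply strictAnti_threshold.injective
    rw [h0]
    simp only
    linarith
  · rintro rfl
    simp only at h0
    linarith
  · rw [abs_lt]
    constructor <;> norm_num <;> linarith
  · have := strictAnti_threshold hs
    rw [h0] at this
    simp only at this
    linarith

end Lozi

namespace Lozi

/-! ### Damped oscillations -/

/-- For `v ≥ 0` both sides are separated by `1 + τv`. For `v = -w ≤ 0`, the function `exp(τw)(cos w
- τ sin w)` starts at 1 and has derivative `-(1 + τ²) exp(τw) sin w ≤ 0` on `[0, π]`. -/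
theorem cos_add_mul_sin_le_exp {τ v : ℝ} (hτ : 0 ≤ τ) (hv : -Real.pi ≤ v) :
    Real.cos v + τ * Real.sin v ≤ Real.exp (τ * v) := by
  rcases le_total 0 v with h | h
  · have h1 := mul_le_mul_of_nonneg_left (Real.sin_le h) hτ
    linarith [Real.cos_le_one v, Real.add_one_le_exp (τ * v)]
  · have hanti : AntitoneOn (fun w => Real.exp (τ * w) * (Real.cos w - τ * Real.sin w))
        (Icc 0 Real.pi) := by
      refine antitoneOn_of_hasDerivWithinAt_nonpos
        (f' := fun w => -((1 + τ ^ 2) * Real.exp (τ * w) * Real.sin w)) (convex_Icc _ _)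
        (by fun_prop) (fun w _ => ?_) (fun w hw => ?_)
      · have h1 : HasDerivAt (fun w => Real.exp (τ * w)) (Real.exp (τ * w) * τ) w := by
          simpa using ((hasDerivAt_id w).const_mul τ).exp
        have h2 := (Real.hasDerivAt_cos w).sub ((Real.hasDerivAt_sin w).const_mul τ)
        refine ((h1.mul h2).congr_deriv ?_).hasDerivWithinAt
        simp only [Pi.sub_apply]
        ring
      · rw [interior_Icc] at hw
        have := Real.sin_pos_of_mem_Ioo hw
        have := Real.exp_pos (τ * w)
        simp only [Left.neg_nonpos_iff]
        positivity
    have := hanti (a := 0) (b := -v) ⟨le_rfl, Real.pi_pos.le⟩ ⟨by linarith, by linarith⟩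
      (by linarith)
    simp only [mul_zero, Real.exp_zero, Real.cos_zero, Real.sin_zero, sub_zero, mul_one,
      Real.cos_neg, Real.sin_neg, mul_neg, sub_neg_eq_add, Real.exp_neg] at this
    rwa [inv_mul_le_iff₀ (Real.exp_pos _), mul_one] at this

/-- The first local maximum of `exp (-τ u) cos u` after the first negative arc dominates
everything that follows. -/
theorem exp_mul_cos_le {τ u : ℝ} (hτ : 0 ≤ τ) (hu : Real.pi - Real.arctan τ ≤ u) :
    Real.exp (-(τ * u)) * Real.cos u ≤
      Real.exp (-(τ * (2 * Real.pi - Real.arctan τ))) / √(1 + τ ^ 2) := by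
  set β := Real.arctan τ with hβ
  -- The point `2π - β` is critical for `exp(-τu) cos u`, since `tan u = -τ` there; `v` is the
  -- distance from it.
  obtain ⟨v, rfl⟩ : ∃ v, u = 2 * Real.pi - β + v := ⟨u - (2 * Real.pi - β), by ring⟩
  have h := cos_add_mul_sin_le_exp (v := v) hτ (by linarith)
  have hcos : Real.cos (2 * Real.pi - β + v) =
      (Real.cos v + τ * Real.sin v) / √(1 + τ ^ 2) := by
    rw [show 2 * Real.pi - β + v = (v - β) + 2 * Real.pi by ring, Real.cos_add_two_pi,
      Real.cos_sub, hβ, Real.cos_arctan, Real.sin_arctan]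
    ring
  have hs : 0 < √(1 + τ ^ 2) := by positivity
  rw [hcos, ← mul_div_assoc]
  gcongr
  calc Real.exp (-(τ * (2 * Real.pi - β + v))) * (Real.cos v + τ * Real.sin v)
      ≤ Real.exp (-(τ * (2 * Real.pi - β + v))) * Real.exp (τ * v) := by gcongr
    _ = Real.exp (-(τ * (2 * Real.pi - β))) := by
      rw [← Real.exp_add]
      ring_nf

theorem cos_add_mul_sin_eq (σ θ : ℝ) : Real.cos θ + σ * Real.sin θ =
    √(1 + σ ^ 2) * Real.cos (θ - Real.arctan σ) := by
  have hs : √(1 + σ ^ 2) ≠ 0 := by positivity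
  rw [Real.cos_sub, Real.cos_arctan, Real.sin_arctan]
  field_simp

/-- An oscillation that starts at its initial level going down stays below that level. -/
theorem damped_lt_one {τ σ θ : ℝ} (hτ : 0 < τ) (hσ : σ < 0) (hθ : 0 < θ)
    (h : √(1 + σ ^ 2) * (Real.exp (-(τ * (2 * Real.pi - Real.arctan τ + Real.arctan σ))) /
      √(1 + τ ^ 2)) < 1) :
    Real.exp (-(τ * θ)) * (Real.cos θ + σ * Real.sin θ) < 1 := by
  have hexp : Real.exp (-(τ * θ)) < 1 := by
    rw [Real.exp_lt_one_iff]
    nlinarith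
  rcases le_or_gt θ Real.pi with hp | hp
  · have hsin := Real.sin_nonneg_of_nonneg_of_le_pi hθ.le hp
    have h1 : Real.cos θ + σ * Real.sin θ ≤ 1 := by
      nlinarith [Real.cos_le_one θ]
    rcases le_or_gt (Real.cos θ + σ * Real.sin θ) 0 with h0 | h0
    · nlinarith [Real.exp_pos (-(τ * θ))]
    · nlinarith [Real.exp_pos (-(τ * θ))]
  · have hneg : Real.arctan σ < 0 := Real.arctan_lt_zero.2 hσ
    have hpos : 0 < Real.arctan τ := Real.arctan_pos.2 hτ
    have := exp_mul_cos_le (u := θ - Real.arctan σ) hτ.le (by linarith)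
    refine lt_of_le_of_lt ?_ h
    rw [cos_add_mul_sin_eq]
    have hfac : Real.exp (-(τ * θ)) =
        Real.exp (-(τ * Real.arctan σ)) * Real.exp (-(τ * (θ - Real.arctan σ))) := by
      rw [← Real.exp_add]
      ring_nf
    have hfac2 : Real.exp (-(τ * (2 * Real.pi - Real.arctan τ + Real.arctan σ))) =
        Real.exp (-(τ * Real.arctan σ)) * Real.exp (-(τ * (2 * Real.pi - Real.arctan τ))) := by
      rw [← Real.exp_add]
      ring_nf
    rw [hfac, hfac2]
    calc _ = √(1 + σ ^ 2) * Real.exp (-(τ * Real.arctan σ)) *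
          (Real.exp (-(τ * (θ - Real.arctan σ))) * Real.cos (θ - Real.arctan σ)) := by ring
      _ ≤ √(1 + σ ^ 2) * Real.exp (-(τ * Real.arctan σ)) *
          (Real.exp (-(τ * (2 * Real.pi - Real.arctan τ))) / √(1 + τ ^ 2)) := by gcongr
      _ = _ := by ring

/-- An oscillation that starts upwards from a positive level stays above `-1`. -/
theorem neg_one_lt_damped {τ μ ν θ : ℝ} (hτ : 0 < τ) (hμ : 0 < μ) (hν : 0 < ν) (hθ : 0 ≤ θ)
    (h : ν * √(1 + (μ / ν) ^ 2) *
      (Real.exp (-(τ * (3 / 2 * Real.pi - Real.arctan τ - Real.arctan (μ / ν)))) /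
        √(1 + τ ^ 2)) < 1) :
    -1 < Real.exp (-(τ * θ)) * (μ * Real.cos θ + ν * Real.sin θ) := by
  set δ := Real.arctan (μ / ν) with hδ
  have hδ0 : 0 < δ := Real.arctan_pos.2 (by positivity)
  rcases le_or_gt θ (Real.pi / 2) with hp | hp
  · have h1 := Real.sin_nonneg_of_nonneg_of_le_pi hθ (by linarith [Real.pi_pos])
    have h2 := Real.cos_nonneg_of_neg_pi_div_two_le_of_le (x := θ)
      (by linarith [Real.pi_pos]) hp
    have : 0 ≤ Real.exp (-(τ * θ)) * (μ * Real.cos θ + ν * Real.sin θ) := by positivity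
    linarith
  · have hpos : 0 < Real.arctan τ := Real.arctan_pos.2 hτ
    -- The negative of the oscillation is a multiple of `cos (θ + π/2 + δ)`, whose phase exceeds `π`
    -- once `θ > π/2`.
    have key := exp_mul_cos_le (u := θ + (Real.pi / 2 + δ)) hτ.le (by linarith)
    have hamp : μ * Real.cos θ + ν * Real.sin θ =
        -(ν * √(1 + (μ / ν) ^ 2) * Real.cos (θ + (Real.pi / 2 + δ))) := by
      have hs : √(1 + (μ / ν) ^ 2) ≠ 0 := by positivity
      rw [show θ + (Real.pi / 2 + δ) = (θ + δ) + Real.pi / 2 by ring, Real.cos_add_pi_div_two,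
        Real.sin_add, hδ, Real.cos_arctan, Real.sin_arctan]
      field_simp
      ring
    have hfac : Real.exp (-(τ * θ)) = Real.exp (τ * (Real.pi / 2 + δ)) *
        Real.exp (-(τ * (θ + (Real.pi / 2 + δ)))) := by
      rw [← Real.exp_add]
      ring_nf
    have hfac2 : Real.exp (-(τ * (3 / 2 * Real.pi - Real.arctan τ - δ))) =
        Real.exp (τ * (Real.pi / 2 + δ)) *
          Real.exp (-(τ * (2 * Real.pi - Real.arctan τ))) := by
      rw [← Real.exp_add]
      ring_nf
    rw [hamp, mul_neg, neg_lt_neg_iff]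
    refine lt_of_le_of_lt ?_ h
    rw [hfac, hfac2]
    calc _ = ν * √(1 + (μ / ν) ^ 2) * Real.exp (τ * (Real.pi / 2 + δ)) *
          (Real.exp (-(τ * (θ + (Real.pi / 2 + δ)))) *
            Real.cos (θ + (Real.pi / 2 + δ))) := by ring
      _ ≤ ν * √(1 + (μ / ν) ^ 2) * Real.exp (τ * (Real.pi / 2 + δ)) *
          (Real.exp (-(τ * (2 * Real.pi - Real.arctan τ))) / √(1 + τ ^ 2)) := by gcongr
      _ = _ := by ring

end Lozi

namespace Lozi

/-! ### The affine return map near `P` -/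

/-- The square of the Lozi map at points of the right half-plane whose image is in the left
half-plane. -/
noncomputable def turn (a b : ℝ) (p : ℝ × ℝ) : ℝ × ℝ :=
  (1 + b * p.1 + a * (1 + p.2 - a * p.1), b * (1 + p.2 - a * p.1))

theorem turn_ptP {a b : ℝ} (ha : 0 < a) : turn a b (ptP a b) = ptP a b := by
  have h : a ^ 2 + (1 - b) ^ 2 ≠ 0 := by positivity
  ext
  · simp only [turn, ptP]
    field_simp
    ring
  · simp only [turn, ptP]
    field_simp
    ring

/-- In suitable coordinates `turn` is a rotation by `φ` around `P` followed by a contraction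
by `b`. -/
theorem turn_iterate {a b c φ : ℝ} (ha : 0 < a) (hb : 0 < b) (hc : 0 < c)
    (hcc : c ^ 2 = b - a ^ 2 / 4) (hcos : Real.cos φ = (b - a ^ 2 / 2) / b)
    (hsin : Real.sin φ = a * c / b) (p : ℝ × ℝ) (k : ℕ) :
    (turn a b)^[k] p =
      ((ptP a b).1 + b ^ k * (Real.cos (k * φ) * (p.1 - (ptP a b).1) + Real.sin (k * φ) *
        ((-(a / 2) * (p.1 - (ptP a b).1) + (p.2 - (ptP a b).2)) / c)),
       (ptP a b).2 + b ^ k * (Real.cos (k * φ) * (p.2 - (ptP a b).2) + Real.sin (k * φ) *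
        ((-b * (p.1 - (ptP a b).1) + a / 2 * (p.2 - (ptP a b).2)) / c))) := by
  -- The linear part of `turn` is `b (cos φ · I + sin φ · J)`, where `J` has rows `(-a/2, 1)/c` and
  -- `(-b, a/2)/c` and satisfies `J² = -I`. Hence powers add angles.
  induction k with
  | zero => ext <;> simp
  | succ k ih =>
    rw [Function.iterate_succ_apply', ih]
    have hP := turn_ptP (b := b) ha
    rw [Prod.ext_iff] at hP
    simp only [turn] at hP
    obtain ⟨h1, h2⟩ := hP
    generalize (ptP a b).1 = X at *
    generalize (ptP a b).2 = Y at *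
    have hC : Real.cos ((k + 1 : ℕ) * φ) =
        Real.cos (k * φ) * ((b - a ^ 2 / 2) / b) - Real.sin (k * φ) * (a * c / b) := by
      rw [← hcos, ← hsin, ← Real.cos_add]
      push_cast
      ring_nf
    have hS : Real.sin ((k + 1 : ℕ) * φ) =
        Real.sin (k * φ) * ((b - a ^ 2 / 2) / b) + Real.cos (k * φ) * (a * c / b) := by
      rw [← hcos, ← hsin, ← Real.sin_add]
      push_cast
      ring_nf
    rw [hC, hS]
    generalize Real.cos (k * φ) = C
    generalize Real.sin (k * φ) = S
    have hb' : b = c ^ 2 + a ^ 2 / 4 := by linarith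
    have hbne : b ≠ 0 := hb.ne'
    ext
    · simp only [turn]
      rw [pow_succ]
      generalize b ^ k = e
      field_simp
      subst hb'
      linear_combination (4 * c) * h1
    · simp only [turn]
      rw [pow_succ]
      generalize b ^ k = e
      field_simp
      subst hb'
      linear_combination (4 * c) * h2

theorem tendsto_turn_iterate {a b c φ : ℝ} (ha : 0 < a) (hb : 0 < b) (hb1 : b < 1) (hc : 0 < c)
    (hcc : c ^ 2 = b - a ^ 2 / 4) (hcos : Real.cos φ = (b - a ^ 2 / 2) / b)
    (hsin : Real.sin φ = a * c / b) (p : ℝ × ℝ) :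
    Tendsto (fun k => (turn a b)^[k] p) atTop (𝓝 (ptP a b)) := by
  have hosc : ∀ A B : ℝ, Tendsto (fun k : ℕ => b ^ k *
      (Real.cos (k * φ) * A + Real.sin (k * φ) * B)) atTop (𝓝 0) := by
    intro A B
    refine squeeze_zero_norm (a := fun k => b ^ k * (|A| + |B|)) (fun k => ?_) ?_
    · rw [norm_mul, Real.norm_of_nonneg (by positivity)]
      gcongr
      refine (norm_add_le _ _).trans ?_
      rw [norm_mul, norm_mul]
      exact add_le_add (mul_le_of_le_one_left (abs_nonneg _) (Real.abs_cos_le_one _))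
        (mul_le_of_le_one_left (abs_nonneg _) (Real.abs_sin_le_one _))
    · simpa using (tendsto_pow_atTop_nhds_zero_of_lt_one hb.le hb1).mul_const (|A| + |B|)
  simp only [turn_iterate ha hb hc hcc hcos hsin p]
  have h := (tendsto_const_nhds (x := (ptP a b).1)).add (hosc (p.1 - (ptP a b).1)
    ((-(a / 2) * (p.1 - (ptP a b).1) + (p.2 - (ptP a b).2)) / c))
  have h' := (tendsto_const_nhds (x := (ptP a b).2)).add (hosc (p.2 - (ptP a b).2)
    ((-b * (p.1 - (ptP a b).1) + a / 2 * (p.2 - (ptP a b).2)) / c))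
  simpa using h.prodMk_nhds h'

end Lozi

namespace Lozi

/-! ### The orbit of `Z` under `turn` for small `a` -/

theorem one_sub_mul_exp_le {t : ℝ} (h0 : 0 < t) (h1 : t < 1) :
    (1 - t) * Real.exp (Real.pi * t / 2) ≤ 1 + t := by
  -- With this `x`, `1 + x = (1+t)/(1-t)` and the bound `2x/(x+2)` is `2t`, which beats `πt/2`.
  have h := Real.le_log_one_add_of_nonneg (x := 2 * t / (1 - t))
    (div_nonneg (by linarith) (by linarith))
  have h1' : 1 - t ≠ 0 := by linarith
  have e1 : 2 * (2 * t / (1 - t)) / (2 * t / (1 - t) + 2) = 2 * t := by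
    field_simp
    ring
  have e2 : 1 + 2 * t / (1 - t) = (1 + t) / (1 - t) := by
    field_simp
    ring
  rw [e1, e2, Real.le_log_iff_exp_le (div_pos (by linarith) (by linarith)),
    le_div_iff₀ (by linarith)] at h
  refine le_trans ?_ h
  rw [mul_comm]
  gcongr
  nlinarith [Real.pi_le_four]

/-- This makes `arctan t` cancel in both critical angles, leaving `5π/4` and `7π/4`. -/
theorem arctan_one_sub_div_one_add {t : ℝ} (h0 : 0 < t) :
    Real.arctan ((1 - t) / (1 + t)) = Real.pi / 4 - Real.arctan t := by
  rw [eq_sub_iff_add_eq, Real.arctan_add, ← Real.arctan_one]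
  · congr 1
    have : 1 + t - t * (1 - t) ≠ 0 := by nlinarith
    field_simp
    ring
  · rw [div_mul_eq_mul_div, div_lt_one (by linarith)]
    nlinarith

theorem sqrt_one_add_sq_one_sub_div {t : ℝ} (h0 : 0 < t) :
    √(1 + ((1 - t) / (1 + t)) ^ 2) = √2 * √(1 + t ^ 2) / (1 + t) := by
  rw [Real.sqrt_eq_iff_mul_self_eq_of_pos (by positivity)]
  rw [div_mul_div_comm, mul_mul_mul_comm, Real.mul_self_sqrt (by positivity),
    Real.mul_self_sqrt (by positivity)]
  field_simp
  ring

/-- The critical value is that of the second coordinate times `κ exp(πt/2)`, and this factor is at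
most 1 by `one_sub_mul_exp_le`. -/
theorem amplitude_fst_lt {t : ℝ} (h0 : 0 < t) (h1 : t < 1)
    (h : √2 * Real.exp (-(7 / 4 * Real.pi * t)) < 1 + t) :
    (1 - t) / (1 + t) * √(1 + ((1 - t) / (1 + t)) ^ 2) *
      (Real.exp (-(t * (3 / 2 * Real.pi - Real.arctan t - Real.arctan ((1 - t) / (1 + t))))) /
        √(1 + t ^ 2)) < 1 := by
  rw [arctan_one_sub_div_one_add h0, sqrt_one_add_sq_one_sub_div h0]
  have hs : √(1 + t ^ 2) ≠ 0 := by positivity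
  have hk := one_sub_mul_exp_le h0 h1
  have e : Real.exp (-(t * (3 / 2 * Real.pi - Real.arctan t - (Real.pi / 4 - Real.arctan t)))) =
      Real.exp (Real.pi * t / 2) * Real.exp (-(7 / 4 * Real.pi * t)) := by
    rw [← Real.exp_add]
    ring_nf
  rw [e]
  set E := Real.exp (Real.pi * t / 2)
  set F := Real.exp (-(7 / 4 * Real.pi * t))
  have e2 : (1 - t) / (1 + t) * (√2 * √(1 + t ^ 2) / (1 + t)) * (E * F / √(1 + t ^ 2)) =
      ((1 - t) * E) * (√2 * F) / (1 + t) ^ 2 := by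
    field_simp
  rw [e2, div_lt_one (by positivity)]
  have hF : 0 ≤ √2 * F := by positivity
  nlinarith

theorem amplitude_snd_lt {t : ℝ} (h0 : 0 < t)
    (h : √2 * Real.exp (-(7 / 4 * Real.pi * t)) < 1 + t) :
    √(1 + (-((1 - t) / (1 + t))) ^ 2) *
      (Real.exp (-(t * (2 * Real.pi - Real.arctan t + Real.arctan (-((1 - t) / (1 + t)))))) /
        √(1 + t ^ 2)) < 1 := by
  rw [neg_sq, Real.arctan_neg, arctan_one_sub_div_one_add h0, sqrt_one_add_sq_one_sub_div h0]
  have hs : √(1 + t ^ 2) ≠ 0 := by positivity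
  have e : Real.exp (-(t * (2 * Real.pi - Real.arctan t + -(Real.pi / 4 - Real.arctan t)))) =
      Real.exp (-(7 / 4 * Real.pi * t)) := by
    ring_nf
  rw [e]
  set F := Real.exp (-(7 / 4 * Real.pi * t))
  have e2 : √2 * √(1 + t ^ 2) / (1 + t) * (F / √(1 + t ^ 2)) = √2 * F / (1 + t) := by
    field_simp
  rwa [e2, div_lt_one (by positivity)]

theorem continuous_amplitude_snd : Continuous fun q : ℝ × ℝ => √(1 + q.2 ^ 2) *
      (Real.exp (-(q.1 * (2 * Real.pi - Real.arctan q.1 + Real.arctan q.2))) /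
        √(1 + q.1 ^ 2)) := by
  have : ∀ q : ℝ × ℝ, √(1 + q.1 ^ 2) ≠ 0 := fun q => by positivity
  fun_prop (disch := assumption)

theorem continuous_amplitude_fst : Continuous fun q : ℝ × ℝ × ℝ => q.2.2 * √(1 + q.2.1 ^ 2) *
      (Real.exp (-(q.1 * (3 / 2 * Real.pi - Real.arctan q.1 - Real.arctan q.2.1))) /
        √(1 + q.1 ^ 2)) := by
  have : ∀ q : ℝ × ℝ × ℝ, √(1 + q.1 ^ 2) ≠ 0 := fun q => by positivity
  fun_prop (disch := assumption)

/-- The parameter `c` with `c ^ 2 = b - a ^ 2 / 4`, for `b = 1 - t a`. -/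
noncomputable def freq (t a : ℝ) : ℝ := √(1 - t * a - a ^ 2 / 4)

/-- The angle of the rotation `turn`, divided by `a`. -/
noncomputable def angle (t a : ℝ) : ℝ :=
  freq t a / (1 - t * a) * dslope Real.arcsin 0 (a * freq t a / (1 - t * a))

/-- The rate of contraction of `turn` per unit angle. -/
noncomputable def damping (t a : ℝ) : ℝ :=
  t * dslope (fun z => -Real.log (1 - z)) 0 (t * a) / angle t a

/-- `a` times the first coordinate of `Z - P`. -/
noncomputable def offsetFst (t a : ℝ) : ℝ :=
  (2 + a + √(a ^ 2 + 4 * (1 - t * a))) / (2 * (1 + t)) - (1 + t) / (1 + t ^ 2)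

/-- `a` times the second coordinate of `Z - P`. -/
noncomputable def offsetSnd (t a : ℝ) : ℝ := (1 - t * a) * (1 - t) / (1 + t ^ 2)

/-- A coefficient of the normalized first coordinate. -/
noncomputable def coeffMu (t a : ℝ) : ℝ := offsetFst t a / ((1 + t) / (1 + t ^ 2))

/-- A coefficient of the normalized first coordinate. -/
noncomputable def coeffNu (t a : ℝ) : ℝ :=
  (-(a / 2) * offsetFst t a + offsetSnd t a) / freq t a / ((1 + t) / (1 + t ^ 2))

/-- The coefficient of the normalized second coordinate. -/
noncomputable def coeffSigma (t a : ℝ) : ℝ :=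
  (-(1 - t * a) * offsetFst t a + a / 2 * offsetSnd t a) / freq t a / offsetSnd t a

/-- The open conditions on `t` and `a` under which the orbit of `Z` is controlled. -/
structure Admissible (t a : ℝ) : Prop where
  lt_one : a < 1
  freq_pos : 0 < 1 - t * a - a ^ 2 / 4
  cos_pos : 0 < 1 - t * a - a ^ 2 / 2
  angle_pos : 0 < angle t a
  damping_pos : 0 < damping t a
  mu_pos : 0 < coeffMu t a
  nu_pos : 0 < coeffNu t a
  sigma_neg : coeffSigma t a < 0
  amplitude_fst : coeffNu t a * √(1 + (coeffMu t a / coeffNu t a) ^ 2) *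
      (Real.exp (-(damping t a * (3 / 2 * Real.pi - Real.arctan (damping t a) -
        Real.arctan (coeffMu t a / coeffNu t a)))) / √(1 + damping t a ^ 2)) < 1
  amplitude_snd : √(1 + coeffSigma t a ^ 2) * (Real.exp (-(damping t a * (2 * Real.pi -
        Real.arctan (damping t a) + Real.arctan (coeffSigma t a)))) /
      √(1 + damping t a ^ 2)) < 1

/-- Because `angle` and `damping` are written with `dslope`, they extend continuously to `a = 0`,
with values 1 and `t`. -/
theorem continuousAt_dslope_arcsin : ContinuousAt (dslope Real.arcsin 0) 0 := by
  rw [continuousAt_dslope_same]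
  exact (Real.hasDerivAt_arcsin (by norm_num) (by norm_num)).differentiableAt

theorem dslope_arcsin_zero : dslope Real.arcsin 0 0 = 1 := by
  rw [dslope_same, (Real.hasDerivAt_arcsin (by norm_num) (by norm_num)).deriv]
  simp

theorem hasDerivAt_neg_log_one_sub : HasDerivAt (fun z : ℝ => -Real.log (1 - z)) 1 0 := by
  have := (((hasDerivAt_id (0 : ℝ)).const_sub 1).log (by norm_num)).neg
  simpa [Pi.neg_def] using this

theorem tendsto_fun_div {α : Type*} {l : Filter α} {f g : α → ℝ} {x y : ℝ}
    (hf : Tendsto f l (𝓝 x)) (hg : Tendsto g l (𝓝 y)) (hy : y ≠ 0) :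
    Tendsto (fun p => f p / g p) l (𝓝 (x / y)) :=
  hf.div hg hy

/-- Each condition is a strict inequality that holds for the limits `angle → 1`, `damping → t`, `μ →
κ²`, `ν → κ`, `σ → -κ`. The neighbourhood is taken in both variables so that one bound on `a` serves
all nearby `t`. -/
theorem eventually_admissible {t : ℝ} (h0 : 0 < t) (h1 : t < 1)
    (h : √2 * Real.exp (-(7 / 4 * Real.pi * t)) < 1 + t) :
    ∀ᶠ p : ℝ × ℝ in 𝓝 (t, 0), Admissible p.1 p.2 := by
  set κ := (1 - t) / (1 + t) with hκ
  have hκ0 : 0 < κ := div_pos (by linarith) (by linarith)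
  have ht : Tendsto (fun p : ℝ × ℝ => p.1) (𝓝 (t, 0)) (𝓝 t) := continuous_fst.tendsto _
  have ha : Tendsto (fun p : ℝ × ℝ => p.2) (𝓝 (t, 0)) (𝓝 0) := continuous_snd.tendsto (t, 0)
  have hta : Tendsto (fun p : ℝ × ℝ => p.1 * p.2) (𝓝 (t, 0)) (𝓝 0) := by
    simpa using ht.mul ha
  have hB : Tendsto (fun p : ℝ × ℝ => 1 - p.1 * p.2) (𝓝 (t, 0)) (𝓝 1) := by
    simpa using hta.const_sub 1
  have hC2 : Tendsto (fun p : ℝ × ℝ => 1 - p.1 * p.2 - p.2 ^ 2 / 4) (𝓝 (t, 0)) (𝓝 1) := by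
    simpa using hB.sub ((ha.pow 2).div_const 4)
  have hcos : Tendsto (fun p : ℝ × ℝ => 1 - p.1 * p.2 - p.2 ^ 2 / 2) (𝓝 (t, 0)) (𝓝 1) := by
    simpa using hB.sub ((ha.pow 2).div_const 2)
  have hC : Tendsto (fun p : ℝ × ℝ => freq p.1 p.2) (𝓝 (t, 0)) (𝓝 1) := by
    simpa [freq] using hC2.sqrt
  have hang : Tendsto (fun p : ℝ × ℝ => angle p.1 p.2) (𝓝 (t, 0)) (𝓝 1) := by
    have hz : Tendsto (fun p : ℝ × ℝ => p.2 * freq p.1 p.2 / (1 - p.1 * p.2)) (𝓝 (t, 0))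
        (𝓝 0) := by
      simpa using tendsto_fun_div (ha.mul hC) hB one_ne_zero
    have := (tendsto_fun_div hC hB one_ne_zero).mul (continuousAt_dslope_arcsin.tendsto.comp hz)
    simpa [angle, dslope_arcsin_zero] using this
  have hdamp : Tendsto (fun p : ℝ × ℝ => damping p.1 p.2) (𝓝 (t, 0)) (𝓝 t) := by
    have hl := (continuousAt_dslope_same.2
      hasDerivAt_neg_log_one_sub.differentiableAt).tendsto.comp hta
    rw [dslope_same, hasDerivAt_neg_log_one_sub.deriv] at hl
    simpa [damping] using tendsto_fun_div (ht.mul hl) hang one_ne_zero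
  have hsq : Tendsto (fun p : ℝ × ℝ => √(p.2 ^ 2 + 4 * (1 - p.1 * p.2))) (𝓝 (t, 0)) (𝓝 2) := by
    have := ((ha.pow 2).add (hB.const_mul 4)).sqrt
    rwa [show (0 : ℝ) ^ 2 + 4 * 1 = 2 ^ 2 by norm_num, Real.sqrt_sq (by norm_num)] at this
  have h1t := ht.const_add 1
  have h1t2 := (ht.pow 2).const_add 1
  have hne1 : 1 + t ≠ 0 := by linarith
  have hne2 : 1 + t ^ 2 ≠ 0 := by positivity
  have hXP := tendsto_fun_div h1t h1t2 hne2
  have hXPne : (1 + t) / (1 + t ^ 2) ≠ 0 := div_ne_zero hne1 hne2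
  have hp : Tendsto (fun p : ℝ × ℝ => offsetFst p.1 p.2) (𝓝 (t, 0))
      (𝓝 (κ ^ 2 * ((1 + t) / (1 + t ^ 2)))) := by
    have e : (2 + 0 + 2) / (2 * (1 + t)) - (1 + t) / (1 + t ^ 2) =
        κ ^ 2 * ((1 + t) / (1 + t ^ 2)) := by
      rw [hκ]
      field_simp
      ring
    rw [← e]
    exact (tendsto_fun_div ((ha.const_add 2).add hsq) (h1t.const_mul 2)
      (by simpa using hne1)).sub hXP
  have hq : Tendsto (fun p : ℝ × ℝ => offsetSnd p.1 p.2) (𝓝 (t, 0))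
      (𝓝 (κ * ((1 + t) / (1 + t ^ 2)))) := by
    have e : 1 * (1 - t) / (1 + t ^ 2) = κ * ((1 + t) / (1 + t ^ 2)) := by
      rw [hκ]
      field_simp
    rw [← e]
    exact tendsto_fun_div (hB.mul (ht.const_sub 1)) h1t2 hne2
  have hμ : Tendsto (fun p : ℝ × ℝ => coeffMu p.1 p.2) (𝓝 (t, 0)) (𝓝 (κ ^ 2)) := by
    have := hp.div hXP hXPne
    rwa [mul_div_cancel_right₀ _ hXPne] at this
  have hν : Tendsto (fun p : ℝ × ℝ => coeffNu p.1 p.2) (𝓝 (t, 0)) (𝓝 κ) := by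
    have := tendsto_fun_div (tendsto_fun_div (((ha.div_const 2).neg.mul hp).add hq) hC
      one_ne_zero) hXP hXPne
    simpa [hXPne, coeffNu] using this
  have hσ : Tendsto (fun p : ℝ × ℝ => coeffSigma p.1 p.2) (𝓝 (t, 0)) (𝓝 (-κ)) := by
    have hκne := hκ0.ne'
    have e : (-1 * (κ ^ 2 * ((1 + t) / (1 + t ^ 2))) + 0 / 2 * (κ * ((1 + t) / (1 + t ^ 2)))) / 1 /
        (κ * ((1 + t) / (1 + t ^ 2))) = -κ := by
      generalize (1 + t) / (1 + t ^ 2) = d at hXPne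
      field_simp
      ring
    rw [← e]
    exact tendsto_fun_div (tendsto_fun_div ((hB.neg.mul hp).add ((ha.div_const 2).mul hq)) hC
      one_ne_zero) hq (mul_ne_zero hκne hXPne)
  have hμν : Tendsto (fun p : ℝ × ℝ => coeffMu p.1 p.2 / coeffNu p.1 p.2) (𝓝 (t, 0))
      (𝓝 κ) := by
    have := hμ.div hν hκ0.ne'
    rwa [sq, mul_div_cancel_right₀ _ hκ0.ne'] at this
  have hA1 := (continuous_amplitude_fst.tendsto (t, κ, κ)).comp
    (hdamp.prodMk_nhds (hμν.prodMk_nhds hν))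
  have hA2 := (continuous_amplitude_snd.tendsto (t, -κ)).comp (hdamp.prodMk_nhds hσ)
  filter_upwards [ha.eventually_lt_const one_pos, hC2.eventually_const_lt one_pos,
    hcos.eventually_const_lt one_pos, hang.eventually_const_lt one_pos,
    hdamp.eventually_const_lt h0, hμ.eventually_const_lt (pow_pos hκ0 2),
    hν.eventually_const_lt hκ0, hσ.eventually_lt_const (neg_neg_iff_pos.2 hκ0),
    hA1.eventually_lt_const (amplitude_fst_lt h0 h1 h),
    hA2.eventually_lt_const (amplitude_snd_lt h0 h)] with p i1 i2 i3 i4 i5 i6 i7 i8 i9 i10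
  exact ⟨i1, i2, i3, i4, i5, i6, i7, i8, i9, i10⟩

end Lozi

/-! ### From admissible parameters to the orbit of `Z` -/

namespace Lozi

/-- Parameters for which the orbit of `Z` under `turn` stays in the fourth quadrant and spirals
to `P`. -/
structure Controlled (a b : ℝ) : Prop where
  a_pos : 0 < a
  b_pos : 0 < b
  b_lt_one : b < 1
  one_sub_lt : 1 - b < a
  lt_one_add : a < 1 + b
  fst_pos : ∀ k : ℕ, 0 < ((turn a b)^[k] (ptZ a b)).1
  snd_neg : ∀ k : ℕ, ((turn a b)^[k + 1] (ptZ a b)).2 < 0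
  tendsto : Tendsto (fun k => (turn a b)^[k] (ptZ a b)) atTop (𝓝 (ptP a b))

theorem fst_ptP_eq {t a : ℝ} (ha : 0 < a) :
    (ptP a (1 - t * a)).1 = (1 + t) / (1 + t ^ 2) / a := by
  have h1 : 1 + t ^ 2 ≠ 0 := by positivity
  have h2 : a ^ 2 + (1 - (1 - t * a)) ^ 2 = a ^ 2 * (1 + t ^ 2) := by ring
  simp only [ptP]
  rw [h2]
  field_simp
  ring

theorem snd_ptP_eq {t a : ℝ} (ha : 0 < a) :
    (ptP a (1 - t * a)).2 = -offsetSnd t a / a := by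
  have h1 : 1 + t ^ 2 ≠ 0 := by positivity
  have h2 : a ^ 2 + (1 - (1 - t * a)) ^ 2 = a ^ 2 * (1 + t ^ 2) := by ring
  simp only [ptP, offsetSnd]
  rw [h2]
  field_simp
  ring

theorem fst_ptZ_sub_ptP {t a : ℝ} (ha : 0 < a) (ht : 0 < t) :
    (ptZ a (1 - t * a)).1 - (ptP a (1 - t * a)).1 = offsetFst t a / a := by
  rw [fst_ptP_eq ha]
  have h1 : 1 + t ≠ 0 := by positivity
  have h2 : 1 + a - (1 - t * a) = a * (1 + t) := by ring
  simp only [ptZ, offsetFst]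
  rw [h2]
  field_simp

/-- With `φ = a · angle` and `θ = kφ`, the factor `b^k` is exactly `exp(-damping · θ)`. Dividing the
coordinates of the orbit by those of `P` then gives the two oscillations bounded by
`neg_one_lt_damped` and `damped_lt_one`. -/
theorem Admissible.controlled {t a : ℝ} (ht : 0 < t) (ht1 : t < 1) (ha : 0 < a)
    (h : Admissible t a) : Controlled a (1 - t * a) := by
  have ha1 := h.lt_one
  have hb : 0 < 1 - t * a := by nlinarith
  have hb1 : 1 - t * a < 1 := by nlinarith
  have hc : 0 < freq t a := Real.sqrt_pos.2 h.freq_pos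
  have hcc : freq t a ^ 2 = 1 - t * a - a ^ 2 / 4 := Real.sq_sqrt h.freq_pos.le
  have hφ : a * angle t a = Real.arcsin (a * freq t a / (1 - t * a)) := by
    have := sub_smul_dslope Real.arcsin 0 (a * freq t a / (1 - t * a))
    rw [Real.arcsin_zero, sub_zero, sub_zero, smul_eq_mul] at this
    rw [← this, angle]
    ring
  have hz : (a * freq t a / (1 - t * a)) ^ 2 =
      1 - ((1 - t * a - a ^ 2 / 2) / (1 - t * a)) ^ 2 := by
    rw [div_pow, div_pow, mul_pow, hcc, eq_sub_iff_add_eq, ← add_div,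
      div_eq_one_iff_eq (by positivity)]
    ring
  have hz1 : (a * freq t a / (1 - t * a)) ^ 2 ≤ 1 := by
    rw [hz]
    have := sq_nonneg ((1 - t * a - a ^ 2 / 2) / (1 - t * a))
    linarith
  have hsin : Real.sin (a * angle t a) = a * freq t a / (1 - t * a) := by
    rw [hφ, Real.sin_arcsin]
    · nlinarith
    · nlinarith
  -- The condition `cos_pos` puts the rotation angle on the branch of `arcsin`.
  have hcos : Real.cos (a * angle t a) = (1 - t * a - a ^ 2 / 2) / (1 - t * a) := by
    rw [hφ, Real.cos_arcsin, hz, sub_sub_cancel, Real.sqrt_sq]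
    exact div_nonneg h.cos_pos.le hb.le
  have hφ0 : 0 < a * angle t a := mul_pos ha h.angle_pos
  have hpow : ∀ k : ℕ, (1 - t * a) ^ k =
      Real.exp (-(damping t a * (k * (a * angle t a)))) := by
    intro k
    have hd : damping t a * (a * angle t a) = -Real.log (1 - t * a) := by
      have := sub_smul_dslope (fun z => -Real.log (1 - z)) 0 (t * a)
      simp only [sub_zero, Real.log_one, neg_zero, smul_eq_mul] at this
      rw [← this, damping]
      have := h.angle_pos.ne'
      field_simp
    rw [show -(damping t a * (k * (a * angle t a))) =
      k * (-(damping t a * (a * angle t a))) by ring, hd, neg_neg, Real.exp_nat_mul,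
      Real.exp_log hb]
  have hq0 : 0 < offsetSnd t a := by
    have : 0 < 1 - t := by linarith
    unfold offsetSnd
    positivity
  have hX0 : 0 < (1 + t) / (1 + t ^ 2) := by positivity
  have hit := turn_iterate ha hb hc hcc hcos hsin (ptZ a (1 - t * a))
  have hZ2 : (ptZ a (1 - t * a)).2 - (ptP a (1 - t * a)).2 = offsetSnd t a / a := by
    rw [snd_ptP_eq ha]
    simp only [ptZ]
    ring
  refine ⟨ha, hb, hb1, by nlinarith, by nlinarith, fun k => ?_, fun k => ?_,
    tendsto_turn_iterate ha hb hb1 hc hcc hcos hsin _⟩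
  · have key := neg_one_lt_damped (θ := k * (a * angle t a)) h.damping_pos h.mu_pos h.nu_pos
      (by positivity) h.amplitude_fst
    rw [hit, hpow k]
    simp only
    rw [fst_ptZ_sub_ptP ha ht, hZ2, fst_ptP_eq ha]
    have e1 : offsetFst t a = coeffMu t a * ((1 + t) / (1 + t ^ 2)) := by
      rw [coeffMu, div_mul_cancel₀ _ hX0.ne']
    have e2 : (-(a / 2) * (offsetFst t a / a) + offsetSnd t a / a) / freq t a =
        coeffNu t a * ((1 + t) / (1 + t ^ 2)) / a := by
      rw [coeffNu, div_mul_cancel₀ _ hX0.ne']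
      ring
    rw [e2, e1]
    generalize (1 + t) / (1 + t ^ 2) = X at hX0
    rw [show ∀ E C S μ ν : ℝ, X / a + E * (C * (μ * X / a) + S * (ν * X / a)) =
      X / a * (1 + E * (μ * C + ν * S)) by intros; ring]
    exact mul_pos (div_pos hX0 ha) (by linarith)
  -- The index starts at 1: `Z` itself is on the horizontal axis, where the inequality is an
  -- equality.
  · have key := damped_lt_one (θ := (k + 1 : ℕ) * (a * angle t a)) h.damping_pos h.sigma_neg
      (by positivity) h.amplitude_snd
    rw [hit, hpow]
    simp only
    rw [fst_ptZ_sub_ptP ha ht, hZ2, snd_ptP_eq ha]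
    have e2 : (-(1 - t * a) * (offsetFst t a / a) + a / 2 * (offsetSnd t a / a)) / freq t a =
        coeffSigma t a * offsetSnd t a / a := by
      rw [coeffSigma, div_mul_cancel₀ _ hq0.ne']
      ring
    rw [e2]
    generalize offsetSnd t a = q at hq0
    rw [show ∀ E C S σ : ℝ, -q / a + E * (C * (q / a) + S * (σ * q / a)) =
      -(q / a * (1 - E * (C + σ * S))) by intros; ring]
    exact neg_neg_of_pos (mul_pos (div_pos hq0 ha) (by linarith))

end Lozi

namespace Lozi

/-! ### Iterates -/

variable {a b : ℝ}

theorem iter_neg (n : ℕ) : iter a b (-(n : ℤ)) = (mapInv a b)^[n] := by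
  cases n <;> rfl

theorem iter_natCast (n : ℕ) : iter a b (n : ℤ) = (map a b)^[n] := rfl

theorem mem_unstableManifold_iff {q : ℝ × ℝ} : q ∈ unstableManifold a b ↔
    Tendsto (fun n => (mapInv a b)^[n] q) atTop (𝓝 (ptX a b)) := by
  simp only [unstableManifold, mem_ofPred_eq, iter_neg]

theorem attractedToPair_iff {p p' q : ℝ × ℝ} : AttractedToPair a b p p' q ↔
    (Tendsto (fun n => (map a b)^[2 * n] q) atTop (𝓝 p) ∧
      Tendsto (fun n => (map a b)^[2 * n + 1] q) atTop (𝓝 p')) ∨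
    (Tendsto (fun n => (map a b)^[2 * n] q) atTop (𝓝 p') ∧
      Tendsto (fun n => (map a b)^[2 * n + 1] q) atTop (𝓝 p)) := by
  have h1 : ∀ n : ℕ, iter a b (2 * (n : ℤ)) = (map a b)^[2 * n] := fun n => by
    exact_mod_cast iter_natCast (2 * n)
  have h2 : ∀ n : ℕ, iter a b (2 * (n : ℤ) + 1) = (map a b)^[2 * n + 1] := fun n => by
    exact_mod_cast iter_natCast (2 * n + 1)
  simp only [AttractedToPair, h1, h2]

/-- A shift of the orbit by one exchanges the parities, hence the two alternatives of the
definition. -/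
theorem attractedToPair_map_iff {p p' q : ℝ × ℝ} :
    AttractedToPair a b p p' (map a b q) ↔ AttractedToPair a b p p' q := by
  have h2 : ∀ x, Tendsto (fun n => (map a b)^[2 * n + 1] (map a b q)) atTop (𝓝 x) ↔
      Tendsto (fun n => (map a b)^[2 * n] q) atTop (𝓝 x) := fun x => by
    rw [← tendsto_add_atTop_iff_nat (f := fun n => (map a b)^[2 * n] q) 1]
    rfl
  have h1 : ∀ x, Tendsto (fun n => (map a b)^[2 * n] (map a b q)) atTop (𝓝 x) ↔
      Tendsto (fun n => (map a b)^[2 * n + 1] q) atTop (𝓝 x) := fun x => Iff.rfl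
  rw [attractedToPair_iff, attractedToPair_iff, h1, h1, h2, h2]
  tauto

theorem attractedToPair_iterate {p p' q : ℝ × ℝ} (h : AttractedToPair a b p p' q) (n : ℕ) :
    AttractedToPair a b p p' ((map a b)^[n] q) := by
  induction n with
  | zero => exact h
  | succ n ih =>
    rw [Function.iterate_succ_apply']
    exact attractedToPair_map_iff.2 ih

theorem continuous_map : Continuous (map a b) := by
  unfold map
  fun_prop

theorem continuous_turn : Continuous (turn a b) := by
  unfold turn
  fun_prop

theorem map_mem_unstableManifold (hb : b ≠ 0) {q : ℝ × ℝ} (h : q ∈ unstableManifold a b) :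
    map a b q ∈ unstableManifold a b := by
  rw [mem_unstableManifold_iff] at h ⊢
  rw [← tendsto_add_atTop_iff_nat 1]
  simpa only [Function.iterate_succ_apply, mapInv_map hb] using h

theorem iterate_mem_unstableManifold (hb : b ≠ 0) {q : ℝ × ℝ}
    (h : q ∈ unstableManifold a b) (n : ℕ) : (map a b)^[n] q ∈ unstableManifold a b := by
  induction n with
  | zero => exact h
  | succ n ih =>
    rw [Function.iterate_succ_apply']
    exact map_mem_unstableManifold hb ih

/-- The second coordinate of `turn p` is `b` times the first coordinate of `L p`, so its sign tells
on which side `L p` lies. -/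
theorem map_map_eq_turn {p : ℝ × ℝ} (h : 0 ≤ p.1) (h' : (turn a b p).2 ≤ 0) (hb : 0 < b) :
    map a b (map a b p) = turn a b p := by
  have h2 : 1 + p.2 - a * p.1 ≤ 0 := by
    simp only [turn] at h'
    exact nonpos_of_mul_nonpos_right h' hb
  simp only [map, turn, abs_of_nonneg h, abs_of_nonpos h2]
  ext
  · simp only
    ring
  · rfl

theorem turn_mem_segment {p x y : ℝ × ℝ} (h : p ∈ segment ℝ x y) :
    turn a b p ∈ segment ℝ (turn a b x) (turn a b y) := by
  obtain ⟨u, v, hu, hv, huv, rfl⟩ := h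
  refine ⟨u, v, hu, hv, huv, ?_⟩
  obtain rfl : u = 1 - v := by linarith
  ext <;> simp [turn] <;> ring

theorem turn_iterate_mem_segment {p x y : ℝ × ℝ} (h : p ∈ segment ℝ x y) (n : ℕ) :
    (turn a b)^[n] p ∈ segment ℝ ((turn a b)^[n] x) ((turn a b)^[n] y) := by
  induction n with
  | zero => exact h
  | succ n ih =>
    simp only [Function.iterate_succ_apply']
    exact turn_mem_segment ih

/-! ### The unstable line of `X` -/

/-- The unstable eigenvalue of `X`. -/
noncomputable def eigU (a b : ℝ) : ℝ := -(a + √(a ^ 2 + 4 * b)) / 2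

/-- The stable eigenvalue of `X`. -/
noncomputable def eigS (a b : ℝ) : ℝ := (-a + √(a ^ 2 + 4 * b)) / 2

/-- The unstable line of `X`, parametrized so that `X` is at `0` and `Z` is at `1`. -/
noncomputable def line (a b s : ℝ) : ℝ × ℝ :=
  (1 / (1 + a - b) * (1 - s * eigU a b), b / (1 + a - b) * (1 - s))

theorem continuous_line : Continuous (line a b) := by
  unfold line
  fun_prop

theorem line_one : line a b 1 = ptZ a b := by
  ext
  · simp only [line, ptZ, eigU]
    rw [← div_div]
    ring
  · simp [line, ptZ]

theorem line_zero : line a b 0 = ptX a b := by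
  simp [line, ptX]

namespace Controlled

variable (H : Controlled a b)
include H

theorem denom_pos : 0 < 1 + a - b := by
  linarith [H.a_pos, H.b_lt_one]

theorem eigU_sq : eigU a b ^ 2 = b - a * eigU a b := by
  have h := Real.sq_sqrt (x := a ^ 2 + 4 * b) (by linarith [H.b_pos, sq_nonneg a])
  unfold eigU
  linear_combination h / 4

theorem eigS_mul_eigU : eigS a b * eigU a b = -b := by
  have h := Real.sq_sqrt (x := a ^ 2 + 4 * b) (by linarith [H.b_pos, sq_nonneg a])
  unfold eigU eigS
  linear_combination -h / 4

theorem eigS_sq : eigS a b ^ 2 = b - a * eigS a b := by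
  have h := Real.sq_sqrt (x := a ^ 2 + 4 * b) (by linarith [H.b_pos, sq_nonneg a])
  unfold eigS
  linear_combination h / 4

theorem eigU_lt : eigU a b < -1 := by
  have h : 2 - a < √(a ^ 2 + 4 * b) := by
    apply Real.lt_sqrt_of_sq_lt
    linarith [H.one_sub_lt]
  unfold eigU
  linarith

theorem eigS_pos : 0 < eigS a b := by
  have h1 := H.eigS_mul_eigU
  have h2 := H.eigU_lt
  have h3 := H.b_pos
  by_contra! h
  nlinarith

theorem eigS_lt_one : eigS a b < 1 := by
  have h1 := H.eigS_sq
  have h2 := H.eigS_pos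
  by_contra! h
  nlinarith [H.a_pos, H.b_lt_one]

theorem one_lt_eigU_sq : 1 < eigU a b ^ 2 := by
  nlinarith [H.eigU_lt]

/-- The bound on `s` places the point in the right half-plane, where `L` is affine and stretches the
unstable direction by its eigenvalue. -/
theorem map_line {s : ℝ} (hs : s * eigU a b ≤ 1) :
    map a b (line a b s) = line a b (s * eigU a b) := by
  have hd := H.denom_pos
  have h0 : 0 ≤ 1 / (1 + a - b) * (1 - s * eigU a b) :=
    mul_nonneg (by positivity) (by linarith)
  have h2 := H.eigU_sq
  ext
  · simp only [map, line, abs_of_nonneg h0]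
    field_simp
    linear_combination s * h2
  · simp only [map, line]
    ring

theorem mapInv_line {s : ℝ} (hs : s ≤ 1) :
    mapInv a b (line a b s) = line a b (s / eigU a b) := by
  have hne : eigU a b ≠ 0 := by linarith [H.eigU_lt]
  have h : s / eigU a b * eigU a b = s := div_mul_cancel₀ _ hne
  rw [← mapInv_map (a := a) H.b_pos.ne' (line a b (s / eigU a b)), H.map_line (by rwa [h]), h]

theorem div_eigU_mem {s : ℝ} (hs : s ∈ Icc (eigU a b)⁻¹ 1) :
    s / eigU a b ∈ Icc (eigU a b)⁻¹ 1 := by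
  have h := H.eigU_lt
  have hneg : eigU a b < 0 := by linarith
  obtain ⟨h1, h2⟩ := hs
  constructor
  · rw [div_eq_mul_inv]
    nlinarith [inv_lt_zero.2 hneg]
  · have : (eigU a b)⁻¹ * eigU a b = 1 := inv_mul_cancel₀ hneg.ne
    rw [div_le_iff_of_neg hneg]
    nlinarith [inv_lt_zero.2 hneg]

theorem mapInv_iterate_line {s : ℝ} (hs : s ∈ Icc (eigU a b)⁻¹ 1) (n : ℕ) :
    s / eigU a b ^ n ∈ Icc (eigU a b)⁻¹ 1 ∧
      (mapInv a b)^[n] (line a b s) = line a b (s / eigU a b ^ n) := by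
  induction n with
  | zero => simpa using hs
  | succ n ih =>
    rw [Function.iterate_succ_apply', ih.2, H.mapInv_line ih.1.2, pow_succ, ← div_div]
    exact ⟨H.div_eigU_mem ih.1, rfl⟩

theorem line_mem_unstableManifold {s : ℝ} (hs : s ∈ Icc (eigU a b)⁻¹ 1) :
    line a b s ∈ unstableManifold a b := by
  rw [mem_unstableManifold_iff, ← line_zero]
  simp only [(H.mapInv_iterate_line hs _).2]
  refine (continuous_line.tendsto 0).comp ?_
  have : Tendsto (fun n => s * (eigU a b)⁻¹ ^ n) atTop (𝓝 (s * 0)) := by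
    refine (tendsto_pow_atTop_nhds_zero_of_abs_lt_one ?_).const_mul s
    rw [abs_inv]
    apply inv_lt_one_of_one_lt₀
    rw [abs_of_neg] <;> linarith [H.eigU_lt]
  simpa [div_eq_mul_inv] using this

/-- Every point of the unstable manifold is an image of a point of the unstable line. -/
theorem exists_eq_iterate_line {q : ℝ × ℝ} (hq : q ∈ unstableManifold a b) :
    ∃ n : ℕ, ∃ s ∈ Icc (eigU a b)⁻¹ 1, q = (map a b)^[n] (line a b s) := by
  rw [mem_unstableManifold_iff] at hq
  set Q := fun n => (mapInv a b)^[n] q with hQ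
  have hd := H.denom_pos
  have hb := H.b_pos
  have hstep : ∀ n, Q n = map a b (Q (n + 1)) := fun n => by
    simp only [hQ, Function.iterate_succ_apply', map_mapInv hb.ne']
  have hback : ∀ n, q = (map a b)^[n] (Q n) := fun n => by
    induction n with
    | zero => rfl
    | succ n ih => rw [Function.iterate_succ_apply, ← hstep, ← ih]
  have hpos : ∀ᶠ n in atTop, 0 < (Q n).1 := by
    have : Tendsto (fun n => (Q n).1) atTop (𝓝 (ptX a b).1) :=
      (continuous_fst.tendsto _).comp hq
    refine this.eventually_const_lt ?_
    simp only [ptX]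
    positivity
  have hs0 : Tendsto (fun n => 1 - (Q n).2 / (b / (1 + a - b))) atTop (𝓝 0) := by
    have h2 : Tendsto (fun n => (Q n).2) atTop (𝓝 (b / (1 + a - b))) :=
      (continuous_snd.tendsto _).comp hq
    have := (h2.div_const (b / (1 + a - b))).const_sub 1
    rwa [div_self (by positivity), sub_self] at this
  have hs : ∀ᶠ n in atTop, 1 - (Q n).2 / (b / (1 + a - b)) ∈ Icc (eigU a b)⁻¹ 1 := by
    apply hs0.eventually
    apply Icc_mem_nhds _ one_pos
    rw [inv_lt_zero]
    linarith [H.eigU_lt]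
  obtain ⟨m, hm⟩ := eventually_atTop.1 hpos
  obtain ⟨n, hn, hns⟩ := ((eventually_ge_atTop m).and hs).exists
  refine ⟨n, _, hns, ?_⟩
  -- The row vector `(eigS, 1)` is a left eigenvector of the linear part of `L` at `X`. Along a
  -- backward orbit in the right half-plane the stable component at time `n` is thus `eigS^j` times
  -- a quantity tending to 0, so it vanishes and the point is on the unstable line.
  have he : ∀ j, eigS a b * ((Q n).1 - 1 / (1 + a - b)) + ((Q n).2 - b / (1 + a - b)) =
      eigS a b ^ j * (eigS a b * ((Q (n + j)).1 - 1 / (1 + a - b)) +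
        ((Q (n + j)).2 - b / (1 + a - b))) := by
    intro j
    induction j with
    | zero => simp
    | succ j ih =>
      have hp := hm (n + (j + 1)) (by omega)
      have h2 := H.eigS_sq
      rw [ih, hstep (n + j), pow_succ, mul_assoc]
      congr 1
      rw [show n + j + 1 = n + (j + 1) by ring]
      generalize Q (n + (j + 1)) = p at *
      simp only [map, abs_of_pos hp]
      field_simp
      linear_combination (1 - p.1 * (1 + a - b)) * h2
  have hzero : eigS a b * ((Q n).1 - 1 / (1 + a - b)) + ((Q n).2 - b / (1 + a - b)) = 0 := by
    have hc : Continuous fun p : ℝ × ℝ =>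
      eigS a b * (p.1 - 1 / (1 + a - b)) + (p.2 - b / (1 + a - b)) := by fun_prop
    have h1 := (tendsto_pow_atTop_nhds_zero_of_lt_one H.eigS_pos.le H.eigS_lt_one).mul
      ((hc.tendsto _).comp (hq.comp (tendsto_add_atTop_nat n)))
    rw [zero_mul] at h1
    refine tendsto_nhds_unique (tendsto_const_nhds.congr fun j => ?_) h1
    rw [he j, add_comm n j]
    rfl
  conv_lhs => rw [hback n]
  congr 1
  have hS := H.eigS_pos
  ext
  · have h1 := H.eigS_mul_eigU
    simp only [line]
    field_simp at hzero ⊢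
    apply mul_left_cancel₀ hS.ne'
    linear_combination b * hzero + (b - (Q n).2 * (1 + a - b)) * h1
  · simp only [line]
    field_simp
    ring

end Controlled

end Lozi

namespace Lozi

variable {a b : ℝ}

/-! ### The unstable manifold of `X` -/

/-- Compact sets that shrink to a point form a compact set together with that point. -/
theorem isCompact_iUnion_union_singleton {M : Type*} [TopologicalSpace M] {K : ℕ → Set M}
    {p : M} (hK : ∀ n, IsCompact (K n))
    (h : ∀ U ∈ 𝓝 p, ∀ᶠ n in atTop, K n ⊆ U) : IsCompact ((⋃ n, K n) ∪ {p}) := by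
  rw [isCompact_iff_ultrafilter_le_nhds]
  intro f hf
  by_cases hp : (f : Filter M) ≤ 𝓝 p
  · exact ⟨p, Or.inr rfl, hp⟩
  · obtain ⟨U, hU, hUf⟩ := Filter.not_le.1 hp
    obtain ⟨N, hN⟩ := eventually_atTop.1 (h U hU)
    have hc : IsCompact (⋃ n ∈ Finset.range N, K n) :=
      (Finset.range N).isCompact_biUnion fun n _ => hK n
    have hmem : (⋃ n ∈ Finset.range N, K n) ∈ f := by
      filter_upwards [le_principal_iff.1 hf, Ultrafilter.compl_mem_iff_notMem.2 hUf] with x hx hxU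
      rcases hx with hx | rfl
      · obtain ⟨n, hn⟩ := mem_iUnion.1 hx
        rcases lt_or_ge n N with hnN | hnN
        · exact mem_biUnion (Finset.mem_coe.2 (Finset.mem_range.2 hnN)) hn
        · exact absurd (hN n hnN hn) hxU
      · exact absurd (mem_of_mem_nhds hU) hxU
    obtain ⟨x, hx, hfx⟩ := isCompact_iff_ultrafilter_le_nhds.1 hc f (le_principal_iff.2 hmem)
    obtain ⟨n, -, hn⟩ := mem_iUnion₂.1 hx
    exact ⟨x, Or.inl (mem_iUnion.2 ⟨n, hn⟩), hfx⟩

/-- A fundamental domain on the unstable line, ending at `Z`. -/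
def fundDomain (a b : ℝ) : Set ℝ := Icc (eigU a b ^ 2)⁻¹ 1

namespace Controlled

variable (H : Controlled a b)
include H

theorem map_ptP : map a b (ptP a b) = ptP' a b := by
  have ha := H.a_pos
  have h := H.one_sub_lt
  have hd : 0 < a ^ 2 + (1 - b) ^ 2 := by positivity
  have h0 : 0 ≤ (1 + a - b) / (a ^ 2 + (1 - b) ^ 2) := div_nonneg H.denom_pos.le hd.le
  ext
  · simp only [map, ptP, ptP', abs_of_nonneg h0]
    field_simp
    ring
  · simp only [map, ptP, ptP']
    ring

theorem fst_ptP'_neg : (ptP' a b).1 < 0 := by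
  have ha := H.a_pos
  have hd : 0 < a ^ 2 + (1 - b) ^ 2 := by positivity
  exact div_neg_of_neg_of_pos (by linarith [H.one_sub_lt]) hd

theorem fst_ptP_pos : 0 < (ptP a b).1 := by
  have ha := H.a_pos
  have hd : 0 < a ^ 2 + (1 - b) ^ 2 := by positivity
  exact div_pos H.denom_pos hd

theorem map_ptP' : map a b (ptP' a b) = ptP a b := by
  have ha := H.a_pos
  have hd : 0 < a ^ 2 + (1 - b) ^ 2 := by positivity
  have h0 := H.fst_ptP'_neg
  ext
  · simp only [map, abs_of_neg h0]
    simp only [ptP, ptP']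
    field_simp
    ring
  · simp only [map, ptP, ptP']
    ring

theorem ptP_ne_ptP' : ptP a b ≠ ptP' a b := fun h => by
  have h1 := H.fst_ptP_pos
  have h2 := H.fst_ptP'_neg
  rw [h] at h1
  linarith

theorem inv_eigU_sq_mem : (eigU a b ^ 2)⁻¹ ∈ Ioo (0 : ℝ) 1 :=
  ⟨inv_pos.2 (by linarith [H.one_lt_eigU_sq]), inv_lt_one_of_one_lt₀ H.one_lt_eigU_sq⟩

theorem pos_of_mem_fundDomain {s : ℝ} (hs : s ∈ fundDomain a b) : 0 < s :=
  H.inv_eigU_sq_mem.1.trans_le hs.1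

/-- The intermediate point `Z^{-1}` is on the vertical axis, the borderline case in which `L²` still
equals `turn`. Hence the images of the fundamental segment join end to end. -/
theorem turn_line_inv_sq : turn a b (line a b (eigU a b ^ 2)⁻¹) = ptZ a b := by
  have hlt := H.eigU_lt
  have hne : eigU a b ≠ 0 := by linarith
  have h0 := H.inv_eigU_sq_mem.1
  have e : (eigU a b ^ 2)⁻¹ * eigU a b = (eigU a b)⁻¹ := by field_simp
  have hneg : (eigU a b)⁻¹ < 0 := inv_lt_zero.2 (by linarith)
  have h1 : map a b (line a b (eigU a b ^ 2)⁻¹) = line a b (eigU a b)⁻¹ := by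
    rw [H.map_line (by linarith), e]
  have h2 : map a b (line a b (eigU a b)⁻¹) = line a b 1 := by
    rw [H.map_line (inv_mul_cancel₀ hne).le, inv_mul_cancel₀ hne]
  have h3 : (line a b (eigU a b)⁻¹).1 = 0 := by
    simp [line, inv_mul_cancel₀ hne]
  have hx : 0 ≤ (line a b (eigU a b ^ 2)⁻¹).1 := by
    simp only [line]
    rw [e]
    exact mul_nonneg (one_div_nonneg.2 H.denom_pos.le) (by linarith)
  rw [← map_map_eq_turn hx _ H.b_pos, h1, h2, line_one]
  have h4 : 1 + (line a b (eigU a b ^ 2)⁻¹).2 - a * (line a b (eigU a b ^ 2)⁻¹).1 = 0 := by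
    rw [← h3, ← h1]
    simp only [map, abs_of_nonneg hx]
  simp only [turn, h4]
  simp

theorem line_mem_segment {s : ℝ} (hs : s ∈ fundDomain a b) :
    line a b s ∈ segment ℝ (line a b (eigU a b ^ 2)⁻¹) (line a b 1) := by
  have hr := H.inv_eigU_sq_mem
  obtain ⟨h1, h2⟩ := hs
  have hne : 1 - (eigU a b ^ 2)⁻¹ ≠ 0 := by linarith [hr.2]
  generalize (eigU a b ^ 2)⁻¹ = r at *
  have hpos : 0 < 1 - r := by linarith [hr.2]
  refine ⟨(1 - s) / (1 - r), (s - r) / (1 - r), div_nonneg (by linarith) hpos.le,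
    div_nonneg (by linarith) hpos.le, ?_, ?_⟩
  · field_simp
    ring
  · have hd := H.denom_pos.ne'
    ext
    · simp only [line, Prod.smul_mk, Prod.mk_add_mk, smul_eq_mul]
      field_simp
      ring
    · simp only [line, Prod.smul_mk, Prod.mk_add_mk, smul_eq_mul]
      field_simp
      ring

theorem turn_iterate_line_mem_segment {s : ℝ} (hs : s ∈ fundDomain a b) (n : ℕ) :
    (turn a b)^[n + 1] (line a b s) ∈
      segment ℝ ((turn a b)^[n] (ptZ a b)) ((turn a b)^[n + 1] (ptZ a b)) := by
  have := turn_iterate_mem_segment (a := a) (b := b) (H.line_mem_segment hs) (n + 1)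
  rwa [Function.iterate_succ_apply _ _ (line a b (eigU a b ^ 2)⁻¹), H.turn_line_inv_sq,
    line_one] at this

theorem snd_nonpos (n : ℕ) : ((turn a b)^[n] (ptZ a b)).2 ≤ 0 := by
  cases n with
  | zero => simp [ptZ]
  | succ n => exact (H.snd_neg n).le

theorem turn_iterate_line_fst_pos {s : ℝ} (hs : s ∈ fundDomain a b) (n : ℕ) :
    0 < ((turn a b)^[n] (line a b s)).1 := by
  cases n with
  | zero =>
    have := H.pos_of_mem_fundDomain hs
    exact mul_pos (one_div_pos.2 H.denom_pos) (by nlinarith [H.eigU_lt])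
  | succ n =>
    have hconv : Convex ℝ {p : ℝ × ℝ | 0 < p.1} :=
      convex_halfSpace_gt (LinearMap.fst ℝ ℝ ℝ).isLinear 0
    exact hconv.segment_subset (H.fst_pos n) (H.fst_pos (n + 1))
      (H.turn_iterate_line_mem_segment hs n)

theorem turn_iterate_line_snd_nonpos {s : ℝ} (hs : s ∈ fundDomain a b) (n : ℕ) :
    ((turn a b)^[n + 1] (line a b s)).2 ≤ 0 := by
  have hconv : Convex ℝ {p : ℝ × ℝ | p.2 ≤ 0} :=
    convex_halfSpace_le (LinearMap.snd ℝ ℝ ℝ).isLinear 0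
  exact hconv.segment_subset (H.snd_nonpos n) (H.snd_nonpos (n + 1))
    (H.turn_iterate_line_mem_segment hs n)

/-- Control of the orbit of `Z` alone suffices: the point lies on a segment whose ends are in convex
half-planes. -/
theorem map_map_turn_iterate_line {s : ℝ} (hs : s ∈ fundDomain a b) (n : ℕ) :
    map a b (map a b ((turn a b)^[n] (line a b s))) = (turn a b)^[n + 1] (line a b s) := by
  rw [Function.iterate_succ_apply']
  apply map_map_eq_turn (H.turn_iterate_line_fst_pos hs n).le _ H.b_pos
  rw [← Function.iterate_succ_apply' (turn a b)]
  exact H.turn_iterate_line_snd_nonpos hs n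

theorem map_iterate_line {s : ℝ} (hs : s ∈ fundDomain a b) (n : ℕ) :
    (map a b)^[2 * n] (line a b s) = (turn a b)^[n] (line a b s) := by
  induction n with
  | zero => rfl
  | succ n ih =>
    rw [show 2 * (n + 1) = 2 * n + 1 + 1 by ring, Function.iterate_succ_apply',
      Function.iterate_succ_apply', ih, H.map_map_turn_iterate_line hs]

theorem one_mem_fundDomain : (1 : ℝ) ∈ fundDomain a b :=
  ⟨H.inv_eigU_sq_mem.2.le, le_rfl⟩

theorem iterate_ptZ_even (k : ℕ) :
    (map a b)^[2 * k + 2] (ptZ a b) ∈ fourthQuadrant := by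
  rw [show 2 * k + 2 = 2 * (k + 1) by ring, ← line_one,
    H.map_iterate_line H.one_mem_fundDomain, line_one]
  exact ⟨H.fst_pos _, H.snd_neg k⟩

theorem iterate_ptZ_odd (k : ℕ) :
    (map a b)^[2 * k + 1] (ptZ a b) ∈ secondQuadrant := by
  have h2 := (H.iterate_ptZ_even k).2
  rw [Function.iterate_succ_apply'] at h2
  refine ⟨?_, ?_⟩
  · simp only [map] at h2
    exact neg_of_mul_neg_right h2 H.b_pos.le
  · rw [Function.iterate_succ_apply', ← line_one, H.map_iterate_line H.one_mem_fundDomain,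
      line_one]
    exact mul_pos H.b_pos (H.fst_pos k)

theorem mem_regionR : (a, b) ∈ regionR := by
  refine ⟨H.b_pos, H.b_lt_one, H.one_sub_lt, H.lt_one_add, fun k => ?_⟩
  simp only
  cases k with
  | zero =>
    -- For `k = 0` the first inequality is an equality, `Z^{-1}` being on the vertical axis.
    refine ⟨?_, ?_⟩
    · have : iter a b (2 * ((0 : ℕ) : ℤ) - 1) = (mapInv a b)^[1] := rfl
      rw [this]
      simp [mapInv, ptZ]
    · exact (H.fst_pos 0).le
  | succ k =>
    have h1 : iter a b (2 * ((k + 1 : ℕ) : ℤ) - 1) = (map a b)^[2 * k + 1] := by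
      rw [show 2 * ((k + 1 : ℕ) : ℤ) - 1 = ((2 * k + 1 : ℕ) : ℤ) by push_cast; ring]
      rfl
    have h2 : iter a b (2 * ((k + 1 : ℕ) : ℤ)) = (map a b)^[2 * k + 2] := by
      rw [show 2 * ((k + 1 : ℕ) : ℤ) = ((2 * k + 2 : ℕ) : ℤ) by push_cast; ring]
      rfl
    rw [h1, h2]
    exact ⟨(H.iterate_ptZ_odd k).1.le, (H.iterate_ptZ_even k).1.le⟩

/-- The convergence is uniform in `s`, because a ball is convex and contains a segment as soon as it
contains the ends. -/
theorem eventually_turn_iterate_line_mem {U : Set (ℝ × ℝ)} (hU : U ∈ 𝓝 (ptP a b)) :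
    ∀ᶠ n in atTop, ∀ s ∈ fundDomain a b, (turn a b)^[n] (line a b s) ∈ U := by
  obtain ⟨ε, hε, hεU⟩ := Metric.mem_nhds_iff.1 hU
  obtain ⟨N, hN⟩ := eventually_atTop.1 (H.tendsto.eventually (Metric.ball_mem_nhds _ hε))
  filter_upwards [eventually_ge_atTop (N + 1)] with n hn s hs
  obtain ⟨m, rfl⟩ : ∃ m, n = m + 1 := ⟨n - 1, by omega⟩
  exact hεU ((convex_ball _ _).segment_subset (hN m (by omega)) (hN (m + 1) (by omega))
    (H.turn_iterate_line_mem_segment hs m))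

theorem tendsto_turn_iterate_line {s : ℝ} (hs : s ∈ fundDomain a b) :
    Tendsto (fun n => (turn a b)^[n] (line a b s)) atTop (𝓝 (ptP a b)) := fun _ hU =>
  (H.eventually_turn_iterate_line_mem hU).mono fun _ h => h s hs

theorem attracted_fundDomain {s : ℝ} (hs : s ∈ fundDomain a b) :
    AttractedToPair a b (ptP a b) (ptP' a b) (line a b s) := by
  rw [attractedToPair_iff]
  left
  simp only [Function.iterate_succ_apply', H.map_iterate_line hs]
  refine ⟨H.tendsto_turn_iterate_line hs, ?_⟩
  rw [← H.map_ptP]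
  exact (continuous_map.tendsto _).comp (H.tendsto_turn_iterate_line hs)

/-- Near `X`, `L²` multiplies `s` by `eigU²`, so finitely many steps bring `s` into the fundamental
domain; `m` counts them. -/
theorem attracted_line_pos {s : ℝ} (h0 : 0 < s) (h1 : s ≤ 1) :
    AttractedToPair a b (ptP a b) (ptP' a b) (line a b s) := by
  have hr := H.inv_eigU_sq_mem
  have hlt := H.eigU_lt
  obtain ⟨m, hm1, hm2⟩ := exists_nat_pow_near_of_lt_one h0 h1 hr.1 hr.2
  induction m generalizing s with
  | zero => exact H.attracted_fundDomain ⟨by simpa using hm1.le, h1⟩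
  | succ m ih =>
    have hsq : 0 < eigU a b ^ 2 := by linarith [H.one_lt_eigU_sq]
    have e : (eigU a b ^ 2)⁻¹ * eigU a b ^ 2 = 1 := inv_mul_cancel₀ hsq.ne'
    generalize hrr : (eigU a b ^ 2)⁻¹ = r at *
    have hle : s * eigU a b * eigU a b ≤ r ^ m := by
      calc s * eigU a b * eigU a b = s * eigU a b ^ 2 := by ring
        _ ≤ r ^ (m + 1) * eigU a b ^ 2 := by gcongr
        _ = r ^ m := by rw [pow_succ, mul_assoc, e, mul_one]
    have hlow : r ^ (m + 1) < s * eigU a b * eigU a b := by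
      calc r ^ (m + 1) = r ^ (m + 1 + 1) * eigU a b ^ 2 := by
            rw [pow_succ r (m + 1), mul_assoc, e, mul_one]
        _ < s * eigU a b ^ 2 := by gcongr
        _ = s * eigU a b * eigU a b := by ring
    have hle1 : s * eigU a b * eigU a b ≤ 1 := hle.trans (pow_le_one₀ hr.1.le hr.2.le)
    rw [← attractedToPair_map_iff, H.map_line (by nlinarith), ← attractedToPair_map_iff,
      H.map_line hle1]
    exact ih ((pow_pos hr.1 _).trans hlow) hle1 hlow hle

theorem attracted {q : ℝ × ℝ} (hq : q ∈ unstableManifold a b) (hne : q ≠ ptX a b) :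
    AttractedToPair a b (ptP a b) (ptP' a b) q := by
  obtain ⟨n, s, hs, rfl⟩ := H.exists_eq_iterate_line hq
  apply attractedToPair_iterate
  have hlt := H.eigU_lt
  -- The unstable eigenvalue is negative, so one step moves a negative parameter to the positive
  -- side.
  rcases lt_trichotomy s 0 with h | rfl | h
  · have hmul : s * eigU a b ≤ 1 := by
      have e : (eigU a b)⁻¹ * eigU a b = 1 := inv_mul_cancel₀ (by linarith)
      nlinarith [hs.1]
    rw [← attractedToPair_map_iff, H.map_line hmul]
    exact H.attracted_line_pos (by nlinarith) hmul
  · refine absurd ?_ hne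
    rw [line_zero]
    exact Function.iterate_fixed (map_ptX H.denom_pos) n
  · exact H.attracted_line_pos h hs.2

/-- The unstable manifold consists of a segment and of the images of the fundamental domain. -/
theorem unstableManifold_eq : unstableManifold a b = line a b '' Icc (eigU a b)⁻¹ 1 ∪
    ((⋃ n : ℕ, (turn a b)^[n] '' (line a b '' fundDomain a b)) ∪
      map a b '' ⋃ n : ℕ, (turn a b)^[n] '' (line a b '' fundDomain a b)) := by
  have hlt := H.eigU_lt
  have hsq := H.one_lt_eigU_sq
  have hinv : (eigU a b)⁻¹ < 0 := inv_lt_zero.2 (by linarith)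
  have e : (eigU a b)⁻¹ * eigU a b = 1 := inv_mul_cancel₀ (by linarith)
  have e2 : (eigU a b ^ 2)⁻¹ * eigU a b ^ 2 = 1 := inv_mul_cancel₀ (by linarith)
  apply Subset.antisymm
  · intro q hq
    obtain ⟨n, s, hs, rfl⟩ := H.exists_eq_iterate_line hq
    induction n with
    | zero => exact Or.inl ⟨s, hs, rfl⟩
    | succ n ih =>
      rw [Function.iterate_succ_apply']
      rcases ih (iterate_mem_unstableManifold H.b_pos.ne' (H.line_mem_unstableManifold hs) n)
        with ⟨u, hu, hq⟩ | h | ⟨p, hp, hq⟩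
      · rw [← hq]
        -- A point of the fundamental domain enters the `L`-images of the `turn` family; below it,
        -- the image is still on the initial segment.
        rcases le_or_gt (eigU a b ^ 2)⁻¹ u with hle | hgt
        · exact Or.inr (Or.inr ⟨_, mem_iUnion.2 ⟨0, _, ⟨u, ⟨hle, hu.2⟩, rfl⟩, rfl⟩, rfl⟩)
        · have h1 : u * eigU a b ≤ 1 := by nlinarith [hu.1]
          refine Or.inl ⟨u * eigU a b, ⟨?_, h1⟩, (H.map_line h1).symm⟩
          have h3 : u * eigU a b ^ 2 ≤ 1 := by nlinarith
          by_contra! hcon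
          nlinarith
      · exact Or.inr (Or.inr ⟨_, h, rfl⟩)
      · rw [← hq]
        obtain ⟨m, _, ⟨u, hu, rfl⟩, rfl⟩ := mem_iUnion.1 hp
        refine Or.inr (Or.inl (mem_iUnion.2 ⟨m + 1, _, ⟨u, hu, rfl⟩, ?_⟩))
        rw [H.map_map_turn_iterate_line hu]
  · have hU : (⋃ n : ℕ, (turn a b)^[n] '' (line a b '' fundDomain a b)) ⊆
        unstableManifold a b := by
      intro q hq
      obtain ⟨m, _, ⟨u, hu, rfl⟩, rfl⟩ := mem_iUnion.1 hq
      rw [← H.map_iterate_line hu]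
      exact iterate_mem_unstableManifold H.b_pos.ne' (H.line_mem_unstableManifold
        ⟨(hinv.trans (H.pos_of_mem_fundDomain hu)).le, hu.2⟩) _
    refine union_subset ?_ (union_subset hU ?_)
    · rintro _ ⟨s, hs, rfl⟩
      exact H.line_mem_unstableManifold hs
    · rintro _ ⟨p, hp, rfl⟩
      exact map_mem_unstableManifold H.b_pos.ne' (hU hp)

/-- The images of the fundamental segment shrink to `P`, so their union with `P` is compact; so is
its image under `L`, which adds `P'`. -/
theorem closure_unstableManifold : closure (unstableManifold a b) =
    unstableManifold a b ∪ {ptP a b, ptP' a b} := by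
  apply Subset.antisymm
  · apply closure_minimal subset_union_left
    set V := ⋃ n : ℕ, (turn a b)^[n] '' (line a b '' fundDomain a b) with hV
    have hVc : IsCompact (V ∪ {ptP a b}) := by
      apply isCompact_iUnion_union_singleton
      · exact fun n => (isCompact_Icc.image continuous_line).image (continuous_turn.iterate n)
      · intro U hU
        filter_upwards [H.eventually_turn_iterate_line_mem hU] with n hn
        rintro _ ⟨_, ⟨s, hs, rfl⟩, rfl⟩
        exact hn s hs
    have heq : unstableManifold a b ∪ {ptP a b, ptP' a b} =
        line a b '' Icc (eigU a b)⁻¹ 1 ∪ ((V ∪ {ptP a b}) ∪ map a b '' (V ∪ {ptP a b})) := by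
      rw [H.unstableManifold_eq, image_union, image_singleton, H.map_ptP, ← hV]
      ext x
      simp only [mem_union, mem_insert_iff, mem_singleton_iff]
      tauto
    rw [heq]
    exact ((isCompact_Icc.image continuous_line).union
      (hVc.union (hVc.image continuous_map))).isClosed
  · have h1 := H.tendsto_turn_iterate_line H.one_mem_fundDomain
    have hmem : ∀ n, (turn a b)^[n] (line a b 1) ∈ unstableManifold a b := fun n => by
      rw [← H.map_iterate_line H.one_mem_fundDomain]
      refine iterate_mem_unstableManifold H.b_pos.ne' (H.line_mem_unstableManifold ⟨?_, le_rfl⟩) _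
      exact (inv_lt_zero.2 (by linarith [H.eigU_lt])).le.trans zero_le_one
    refine union_subset subset_closure (insert_subset ?_ (singleton_subset_iff.2 ?_))
    · exact mem_closure_of_tendsto h1 (Eventually.of_forall hmem)
    · rw [← H.map_ptP]
      exact mem_closure_of_tendsto ((continuous_map.tendsto _).comp h1)
        (Eventually.of_forall fun n => map_mem_unstableManifold H.b_pos.ne' (hmem n))

end Controlled

end Lozi

namespace Lozi

/-! ### The region of parameters -/

/-- The valid bounds at each `t` form a convex set, and near each `t` a constant is valid; a
partition of unity yields a continuous selection. -/
theorem exists_continuous_bound {t₀ : ℝ} (h0 : 0 < t₀)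
    (h : ∀ s, t₀ < s → √2 * Real.exp (-(7 / 4 * Real.pi * s)) < 1 + s) :
    ∃ α : ℝ → ℝ, ContinuousOn α (Ioo t₀ 1) ∧ (∀ t ∈ Ioo t₀ 1, 0 < α t) ∧
      ∀ t ∈ Ioo t₀ 1, ∀ a, 0 < a → a < α t → Controlled a (1 - t * a) := by
  obtain ⟨g, hg⟩ := exists_continuous_forall_mem_convex_of_local_const
    (t := fun t : Ioo t₀ 1 => {ε : ℝ | 0 < ε ∧ ∀ a, 0 < a → a < ε → Controlled a (1 - t * a)})
    (fun t => by
      refine OrdConnected.convex ⟨?_⟩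
      rintro x hx y hy z hz
      exact ⟨hx.1.trans_le hz.1, fun a ha haz => hy.2 a ha (haz.trans_le hz.2)⟩)
    (fun t => by
      have ht0 : 0 < (t : ℝ) := h0.trans t.2.1
      obtain ⟨ε, hε, hball⟩ := Metric.eventually_nhds_iff_ball.1
        (eventually_admissible ht0 t.2.2 (h t t.2.1))
      refine ⟨ε, ?_⟩
      filter_upwards [Metric.ball_mem_nhds t hε] with s hs
      refine ⟨hε, fun a ha haε => Admissible.controlled (h0.trans s.2.1) s.2.2 ha ?_⟩
      refine hball ((s : ℝ), a) ?_
      rw [Metric.mem_ball, Prod.dist_eq, max_lt_iff]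
      refine ⟨hs, ?_⟩
      rwa [Real.dist_eq, sub_zero, abs_of_pos ha])
  have hval : ∀ t (ht : t ∈ Ioo t₀ 1),
      (fun s => if hs : s ∈ Ioo t₀ 1 then g ⟨s, hs⟩ else 0) t = g ⟨t, ht⟩ := fun t ht =>
    dif_pos ht
  refine ⟨fun s => if hs : s ∈ Ioo t₀ 1 then g ⟨s, hs⟩ else 0, ?_, fun t ht => ?_,
    fun t ht a ha hlt => ?_⟩
  · rw [continuousOn_iff_continuous_domRestrict]
    convert g.continuous using 1
    ext t
    exact hval t t.2
  · rw [hval t ht]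
    exact (hg ⟨t, ht⟩).1
  · rw [hval t ht] at hlt
    exact (hg ⟨t, ht⟩).2 a ha hlt

variable {t₀ : ℝ} {α : ℝ → ℝ}

/-- The point determines `t` as `(1 - b)/a`, which turns membership into conditions continuous in
`(a, b)`. -/
theorem mem_parameterRegion_iff {c : ℝ × ℝ} : c ∈ parameterRegion t₀ α ↔
    0 < c.1 ∧ (1 - c.2) / c.1 ∈ Ioo t₀ 1 ∧ c.1 < α ((1 - c.2) / c.1) := by
  constructor
  · rintro ⟨t, ht, h1, h2, h3⟩
    have : (1 - c.2) / c.1 = t := by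
      rw [h3]
      field_simp
      ring
    rw [this]
    exact ⟨h1, ht, h2⟩
  · rintro ⟨h1, ht, h2⟩
    refine ⟨_, ht, h1, h2, ?_⟩
    field_simp
    ring

theorem isOpen_parameterRegion (hα : ContinuousOn α (Ioo t₀ 1)) :
    IsOpen (parameterRegion t₀ α) := by
  rw [isOpen_iff_mem_nhds]
  intro c hc
  obtain ⟨h1, ht, h2⟩ := mem_parameterRegion_iff.1 hc
  have hf : ContinuousAt (fun c : ℝ × ℝ => c.1) c := continuousAt_fst
  have ht' : ContinuousAt (fun c : ℝ × ℝ => (1 - c.2) / c.1) c :=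
    (continuousAt_const.sub continuousAt_snd).div hf h1.ne'
  have hα' : ContinuousAt (fun c : ℝ × ℝ => α ((1 - c.2) / c.1)) c :=
    ContinuousAt.comp (f := fun c : ℝ × ℝ => (1 - c.2) / c.1)
      (hα.continuousAt (isOpen_Ioo.mem_nhds ht)) ht'
  filter_upwards [hf.eventually (lt_mem_nhds h1), ht'.eventually (isOpen_Ioo.mem_nhds ht),
    hf.eventually_lt hα' h2] with x i1 i2 i3
  exact mem_parameterRegion_iff.2 ⟨i1, i2, i3⟩

/-- The parameter region is a curvilinear image of a rectangle. -/
noncomputable def parameterRegionHomeomorph (hα : ContinuousOn α (Ioo t₀ 1))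
    (hpos : ∀ t ∈ Ioo t₀ 1, 0 < α t) :
    (Ioo t₀ 1 ×ˢ Ioo (0 : ℝ) 1 : Set (ℝ × ℝ)) ≃ₜ parameterRegion t₀ α where
  toFun x := ⟨(x.1.2 * α x.1.1, 1 - x.1.1 * (x.1.2 * α x.1.1)), x.1.1, x.2.1,
    mul_pos x.2.2.1 (hpos _ x.2.1), mul_lt_of_lt_one_left (hpos _ x.2.1) x.2.2.2, rfl⟩
  invFun c := ⟨((1 - c.1.2) / c.1.1, c.1.1 / α ((1 - c.1.2) / c.1.1)), by
    obtain ⟨h1, ht, h2⟩ := mem_parameterRegion_iff.1 c.2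
    exact ⟨ht, div_pos h1 (hpos _ ht), (div_lt_one (hpos _ ht)).2 h2⟩⟩
  left_inv x := by
    obtain ⟨⟨t, s⟩, ht, hs⟩ := x
    have h1 := hpos t ht
    have h2 := hs.1
    have h3 : (1 - (1 - t * (s * α t))) / (s * α t) = t := by
      have : s * α t ≠ 0 := (mul_pos h2 h1).ne'
      rw [sub_sub_cancel, mul_div_cancel_right₀ _ this]
    refine Subtype.ext (Prod.ext h3 ?_)
    simp only [h3]
    exact mul_div_cancel_right₀ _ h1.ne'
  right_inv c := by
    obtain ⟨⟨a, b⟩, hc⟩ := c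
    obtain ⟨h1, ht, -⟩ := mem_parameterRegion_iff.1 hc
    have h2 := (hpos _ ht).ne'
    simp only at h1 h2
    simp only [div_mul_cancel₀ _ h2, div_mul_cancel₀ _ h1.ne',
      sub_sub_cancel]
  continuous_toFun := by
    have hc : Continuous fun x : (Ioo t₀ 1 ×ˢ Ioo (0 : ℝ) 1 : Set (ℝ × ℝ)) => α x.1.1 :=
      hα.comp_continuous (by fun_prop) fun x => x.2.1
    have ht : Continuous fun x : (Ioo t₀ 1 ×ˢ Ioo (0 : ℝ) 1 : Set (ℝ × ℝ)) => x.1.1 := by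
      fun_prop
    have hs := (continuous_snd.comp continuous_subtype_val).mul hc
    exact (hs.prodMk (continuous_const.sub (ht.mul hs))).subtype_mk _
  continuous_invFun := by
    have hne : ∀ c : parameterRegion t₀ α, c.1.1 ≠ 0 := fun c =>
      (mem_parameterRegion_iff.1 c.2).1.ne'
    have ht : Continuous fun c : parameterRegion t₀ α => (1 - c.1.2) / c.1.1 := by
      fun_prop (disch := assumption)
    have hc : Continuous fun c : parameterRegion t₀ α => α ((1 - c.1.2) / c.1.1) :=
      hα.comp_continuous ht fun c => (mem_parameterRegion_iff.1 c.2).2.1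
    have hne' : ∀ c : parameterRegion t₀ α, α ((1 - c.1.2) / c.1.1) ≠ 0 := fun c =>
      (hpos _ (mem_parameterRegion_iff.1 c.2).2.1).ne'
    exact (ht.prodMk ((continuous_fst.comp continuous_subtype_val).div hc hne')).subtype_mk _

theorem isSimplyConnected_parameterRegion (ht₀ : t₀ < 1) (hα : ContinuousOn α (Ioo t₀ 1))
    (hpos : ∀ t ∈ Ioo t₀ 1, 0 < α t) : IsSimplyConnected (parameterRegion t₀ α) := by
  have hconv : Convex ℝ (Ioo t₀ 1 ×ˢ Ioo (0 : ℝ) 1) := (convex_Ioo _ _).prod (convex_Ioo _ _)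
  have : ContractibleSpace (Ioo t₀ 1 ×ˢ Ioo (0 : ℝ) 1 : Set (ℝ × ℝ)) :=
    hconv.contractibleSpace ((nonempty_Ioo.2 ht₀).prod (nonempty_Ioo.2 one_pos))
  have : ContractibleSpace (parameterRegion t₀ α) :=
    (parameterRegionHomeomorph hα hpos).symm.contractibleSpace
  exact SimplyConnectedSpace.ofContractible _

theorem zero_one_mem_closure_parameterRegion (ht₀ : t₀ < 1) (hpos : ∀ t ∈ Ioo t₀ 1, 0 < α t) :
    ((0 : ℝ), (1 : ℝ)) ∈ closure (parameterRegion t₀ α) := by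
  obtain ⟨t, ht⟩ := nonempty_Ioo.2 ht₀
  have hlim : Tendsto (fun a : ℝ => (a, 1 - t * a)) (𝓝[>] 0) (𝓝 (0, 1)) := by
    have hc : Continuous fun a : ℝ => (a, 1 - t * a) := by fun_prop
    have := hc.tendsto 0
    simp only [mul_zero, sub_zero] at this
    exact this.mono_left nhdsWithin_le_nhds
  refine mem_closure_of_tendsto hlim ?_
  filter_upwards [Ioo_mem_nhdsGT (hpos t ht)] with a ha
  exact ⟨t, ht, ha.1, ha.2, rfl⟩

end Lozi

theorem theorem2 :
    ∃ t₀ : ℝ,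
      (∀ s : ℝ, √2 * Real.exp (-(7 / 4 * Real.pi * s)) = 1 + s ↔ s = t₀) ∧
      |t₀ - 0.0535502597736068| < 1 / 10 ^ 16 ∧
      ∃ α : ℝ → ℝ,
        LowerSemicontinuousOn α (Set.Ioo t₀ 1) ∧
        (∀ t ∈ Set.Ioo t₀ 1, 0 < α t) ∧
        (∀ t ∈ Set.Ioo t₀ 1, ∀ a b : ℝ, 0 < a → a < α t → b = 1 - t * a →
          (∀ k : ℕ, Lozi.iter a b (2 * (k : ℤ) + 2) (Lozi.ptZ a b) ∈ Lozi.fourthQuadrant) ∧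
          (∀ k : ℕ, Lozi.iter a b (2 * (k : ℤ) + 1) (Lozi.ptZ a b) ∈ Lozi.secondQuadrant) ∧
          (a, b) ∈ Lozi.regionR ∧
          Lozi.map a b (Lozi.ptP a b) = Lozi.ptP' a b ∧
          Lozi.map a b (Lozi.ptP' a b) = Lozi.ptP a b ∧
          Lozi.ptP a b ≠ Lozi.ptP' a b ∧
          (∀ q ∈ Lozi.unstableManifold a b, q ≠ Lozi.ptX a b →
            Lozi.AttractedToPair a b (Lozi.ptP a b) (Lozi.ptP' a b) q) ∧
          closure (Lozi.unstableManifold a b) =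
            Lozi.unstableManifold a b ∪ {Lozi.ptP a b, Lozi.ptP' a b}) ∧
        Lozi.parameterRegion t₀ α ⊆ Lozi.regionR ∧
        IsOpen (Lozi.parameterRegion t₀ α) ∧
        IsSimplyConnected (Lozi.parameterRegion t₀ α) ∧
        ((0 : ℝ), (1 : ℝ)) ∈ closure (Lozi.parameterRegion t₀ α) := by
  obtain ⟨t₀, h0, h1, hroot, happrox, hlt⟩ := Lozi.exists_threshold
  obtain ⟨α, hα, hpos, hctl⟩ := Lozi.exists_continuous_bound h0 hlt
  refine ⟨t₀, hroot, happrox, α, hα.lowerSemicontinuousOn, hpos, ?_, ?_,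
    Lozi.isOpen_parameterRegion hα, Lozi.isSimplyConnected_parameterRegion h1 hα hpos,
    Lozi.zero_one_mem_closure_parameterRegion h1 hpos⟩
  · rintro t ht a b ha haα rfl
    have H := hctl t ht a ha haα
    refine ⟨fun k => ?_, fun k => ?_, H.mem_regionR, H.map_ptP, H.map_ptP', H.ptP_ne_ptP',
      fun q hq hne => H.attracted hq hne, H.closure_unstableManifold⟩
    · have := H.iterate_ptZ_even k
      exact_mod_cast (Lozi.iter_natCast (2 * k + 2)).symm ▸ this
    · have := H.iterate_ptZ_odd k
      exact_mod_cast (Lozi.iter_natCast (2 * k + 1)).symm ▸ this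
  · rintro ⟨a, b⟩ ⟨t, ht, ha, haα, hb⟩
    simp only at ha haα hb
    rw [hb]
    exact (hctl t ht a ha haα).mem_regionR
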